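/- Let $A$ be a self-adjoint (possibly unbounded) operator with domain $\operatorname{D}(A)$ in a complex Hilbert space $\mathcal{H}$, and let $\mathcal{L}=(\mathcal{L}_n)_{n\in\mathbb{N}}$ be a sequence of finite-dimensional subspaces of $\mathcal{H}$. For an operator $T$ in $\mathcal H$, the sequence $\mathcal{L}$ is called a *$T$-regular Galerkin sequence* if $\mathcal{L}_n\subset\operatorname{D}(T)$ for all $n$ and for every $f\in\operatorname{D}(T)$ there are $f_n\in\mathcal{L}_n$ with $\|f_n-f\|+\|Tf_n-Tf\|\to0$ as $n\to\infty$. Assume that one of the following holds: (a) $\mathcal{L}$ is $A$-regular; in this case let $A_n=\pi_nA|_{\mathcal{L}_n}:\mathcal{L}_n\to\mathcal{L}_n$, where $\pi_n$ is the orthogonal projection of $\mathcal{H}$ onto $\mathcal{L}_n$; (b) $A\geq0$ and $\mathcal{L}$ is $A^{1/2}$-regular, where $A^{1/2}$ is the nonnegative self-adjoint square root of $A$; in this case let $A_n:\mathcal{L}_n\to\mathcal{L}_n$ be the compression of $A$ in the form sense, that is, the linear map determined by $\langle z,A_nx\rangle=\langle A^{1/2}z,A^{1/2}x\rangle$ for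 all $x,z\in\mathcal{L}_n$. Let the *limiting spectrum* $\sigma(A,\mathcal{L})$ be the set of all $\lambda\in\mathbb{R}$ for which there exist $n_k\to\infty$ and $\lambda_k\in\sigma(A_{n_k})$ with $\lambda_k\to\lambda$ as $k\to\infty$. Then $$\sigma(A)\subset\sigma(A,\mathcal{L})$$ and $$\sigma_{\mathrm{poll}}(A,\mathcal{L}):=\sigma(A,\mathcal{L})\setminus\sigma(A)\subset(\ell^-,\ell^+),$$ where $$\ell^-:=\begin{cases}-\infty&\text{if }\inf\sigma(A)=-\infty,\\ \inf\sigma_{\mathrm{ess}}(A)&\text{otherwise,}\end{cases}\qquad \ell^+:=\begin{cases}+\infty&\text{if }\sup\sigma(A)=+\infty,\\ \sup\sigma_{\mathrm{ess}}(A)&\text{otherwise.}\end{cases}$$ Here $\inf\emptyset=+\infty$, $\sup\emptyset=-\infty$, $(\ell^-,\ell^+)=\{t\in\mathbb{R}:\ell^-<t<\ell^+\}$, and $\sigma_{\mathrm{ess}}(A)$ is the essential spectrum: the set of all $\lambda$ for which there are $x_k\in\operatorname{D}(A)$ with $\|x_k\|=1$, $x_k\rightharpoonup0$ weakly and $(A-\lambda)x_k\to0$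 in norm. -/

import Mathlib

open Filter Topology

noncomputable section

namespace Galerkin

variable {H : Type*} [NormedAddCommGroup H] [InnerProductSpace ℂ H]

/-! ### Spectra of unbounded operators -/

/-- The resolvent set of a (possibly unbounded) operator `T` with domain `T.domain`: all `z` for
which `T - z` is a bijection of `T.domain` onto `H` with bounded inverse `R`. -/
def resolventSet (T : H →ₗ.[ℂ] H) : Set ℂ :=
  {z | ∃ R : H →L[ℂ] H,
    (∀ u : H, ∃ h : R u ∈ T.domain, T ⟨R u, h⟩ - z • R u = u) ∧
    (∀ x : T.domain, R (T x - z • (x : H)) = x)}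

/-- The spectrum `σ(T)`. -/
def spectrum (T : H →ₗ.[ℂ] H) : Set ℂ := (resolventSet T)ᶜ

/-- The essential spectrum `σ_ess(T)` of a self-adjoint operator `T`: all `z` that have a singular
Weyl sequence, that is, normalised vectors `x k` in the domain of `T` which converge weakly to `0`
and satisfy `(T - z) (x k) → 0`. -/
def essSpectrum (T : H →ₗ.[ℂ] H) : Set ℂ :=
  {z | ∃ x : ℕ → T.domain, (∀ k, ‖(x k : H)‖ = 1) ∧
    (∀ y : H, Tendsto (fun k => inner ℂ y (x k : H)) atTop (𝓝 0)) ∧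
    Tendsto (fun k => T (x k) - z • (x k : H)) atTop (𝓝 0)}

/-- The real points of a set of complex numbers, as a subset of the extended real line. -/
def realPoints (S : Set ℂ) : Set EReal := {x | ∃ t : ℝ, (t : ℂ) ∈ S ∧ x = (t : EReal)}

open scoped Classical in
/-- `ℓ⁻`, the value being `-∞` if `inf σ(T) = -∞`, and `inf σ_ess(T)` otherwise
(with `inf ∅ = +∞`). -/
def ellMinus (T : H →ₗ.[ℂ] H) : EReal :=
  if sInf (realPoints (spectrum T)) = ⊥ then ⊥ else sInf (realPoints (essSpectrum T))

open scoped Classical in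
/-- `ℓ⁺`, the value being `+∞` if `sup σ(T) = +∞`, and `sup σ_ess(T)` otherwise
(with `sup ∅ = -∞`). -/
def ellPlus (T : H →ₗ.[ℂ] H) : EReal :=
  if sSup (realPoints (spectrum T)) = ⊤ then ⊤ else sSup (realPoints (essSpectrum T))

/-! ### Galerkin sequences and compressions -/

/-- `L` is a `T`-regular Galerkin sequence: the subspaces `L n` lie in the domain of `T`, and every
`f` in the domain of `T` is the limit, in the graph norm of `T`, of vectors `g n ∈ L n`.
(Finite dimensionality of the `L n` is a separate assumption.) -/
def IsRegular (T : H →ₗ.[ℂ] H) (L : ℕ → Submodule ℂ H) : Prop :=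
  (∀ n, L n ≤ T.domain) ∧
  ∀ f : T.domain, ∃ g : ℕ → T.domain, (∀ n, (g n : H) ∈ L n) ∧
    Tendsto (fun n => ‖(g n : H) - f‖ + ‖T (g n) - T f‖) atTop (𝓝 0)

/-- The restriction of an operator `T` to a subspace `V` of its domain. -/
def restrict (T : H →ₗ.[ℂ] H) (V : Submodule ℂ H) (hV : V ≤ T.domain) : V →ₗ[ℂ] H :=
  T.toFun ∘ₗ Submodule.inclusion hV

/-- The compression `π_V T|_V : V → V`, where `π_V` is the orthogonal projection onto `V`. -/
def compression (T : H →ₗ.[ℂ] H) (V : Submodule ℂ H) [FiniteDimensional ℂ V]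
    (hV : V ≤ T.domain) : Module.End ℂ V :=
  V.orthogonalProjectionOnto.toLinearMap ∘ₗ restrict T V hV

/-- The compression to `V` of the quadratic form `x ↦ ‖B x‖²`, that is, `(B|_V)^* (B|_V)`. For
`B = A^{1/2}` and `V` in the form domain of `A` it is the compression of `A` to `V` in the form
sense; its defining property is `inner_formCompression`. -/
def formCompression (B : H →ₗ.[ℂ] H) (V : Submodule ℂ H) [FiniteDimensional ℂ V]
    (hV : V ≤ B.domain) [CompleteSpace H] : Module.End ℂ V :=
  haveI : CompleteSpace V := FiniteDimensional.complete ℂ V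
  (ContinuousLinearMap.adjoint (LinearMap.toContinuousLinearMap (restrict B V hV))).toLinearMap ∘ₗ
    restrict B V hV

theorem inner_formCompression (B : H →ₗ.[ℂ] H) (V : Submodule ℂ H) [FiniteDimensional ℂ V]
    (hV : V ≤ B.domain) [CompleteSpace H] (z x : V) :
    inner ℂ (z : H) (formCompression B V hV x : H) =
      inner ℂ (B ⟨z, hV z.2⟩) (B ⟨x, hV x.2⟩) := by
  have : CompleteSpace V := FiniteDimensional.complete ℂ V
  exact ContinuousLinearMap.adjoint_inner_right
    (LinearMap.toContinuousLinearMap (restrict B V hV)) z (restrict B V hV x)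

/-- The limiting spectrum of a sequence of operators `An n` on the subspaces `L n`: all real `t`
which are limits of some `μ k ∈ σ(An (φ k))` with `φ k → ∞`. -/
def limitingSpectrum (L : ℕ → Submodule ℂ H) (An : ∀ n, Module.End ℂ (L n)) : Set ℝ :=
  {t | ∃ (φ : ℕ → ℕ) (μ : ℕ → ℂ), Tendsto φ atTop atTop ∧
    (∀ k, μ k ∈ _root_.spectrum ℂ (An (φ k))) ∧ Tendsto μ atTop (𝓝 (t : ℂ))}

/-- The pollution set `σ(T, L) ∖ σ(T)`, where `σTL` is the limiting spectrum `σ(T, L)`. -/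
def pollution (T : H →ₗ.[ℂ] H) (σTL : Set ℝ) : Set ℝ := {t ∈ σTL | (t : ℂ) ∉ spectrum T}

/-! ### The square root of a nonnegative self-adjoint operator -/

/-- `T ≥ 0`. -/
def Nonneg (T : H →ₗ.[ℂ] H) : Prop := ∀ x : T.domain, 0 ≤ (inner ℂ (x : H) (T x)).re

/-- `B` is the nonnegative self-adjoint square root of `T`: `B` is self-adjoint, `B ≥ 0` and
`B² = T` as operators, where `B²` has the domain `{x ∈ dom B | B x ∈ dom B}`. -/
structure IsPosSqrt [CompleteSpace H] (B T : H →ₗ.[ℂ] H) : Prop where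
  selfAdjoint : IsSelfAdjoint B
  nonneg : Nonneg B
  mem_iff : ∀ x : H, x ∈ T.domain ↔ ∃ h : x ∈ B.domain, B ⟨x, h⟩ ∈ B.domain
  apply_eq : ∀ (x : T.domain) (h : (x : H) ∈ B.domain) (h' : B ⟨x, h⟩ ∈ B.domain),
    B ⟨B ⟨x, h⟩, h'⟩ = T x

/-- For `T = T^* ≥ 0`, the operator `1 + T` has an everywhere defined bounded inverse `R`. -/
theorem exists_inverse [CompleteSpace H] {T : H →ₗ.[ℂ] H} (hT : IsSelfAdjoint T)
    (hpos : Nonneg T) : ∃ R : H →L[ℂ] H,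
      (∀ u : H, ∃ h : R u ∈ T.domain, T ⟨R u, h⟩ + R u = u) ∧
      (∀ x : T.domain, R (T x + (x : H)) = x) ∧ 0 ≤ R ∧ R ≤ 1 := by
  have hadj : T.adjoint = T := hT
  have hdense := hT.dense_domain
  have hsym : ∀ x y : T.domain, inner ℂ (T x) (y : H) = inner ℂ (x : H) (T y) := by
    have h := LinearPMap.adjoint_isFormalAdjoint hdense
    rw [hadj] at h
    exact h
  -- the map `1 + T` and its lower bound
  let S : T.domain →ₗ[ℂ] H := T.toFun + T.domain.subtype
  have hSapp : ∀ x : T.domain, S x = T x + (x : H) := fun x => rfl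
  have hre : ∀ x : T.domain, ‖(x : H)‖ ^ 2 ≤ (inner ℂ (x : H) (S x)).re := by
    intro x
    rw [hSapp, inner_add_right, Complex.add_re]
    have h1 : (inner ℂ (x : H) (x : H) : ℂ).re = ‖(x : H)‖ ^ 2 := by
      rw [inner_self_eq_norm_sq_to_K]; norm_cast
    have := hpos x
    linarith
  have hlow : ∀ x : T.domain, ‖(x : H)‖ ≤ ‖S x‖ := by
    intro x
    have h1 := hre x
    have h2 : (inner ℂ (x : H) (S x)).re ≤ ‖(x : H)‖ * ‖S x‖ :=
      (Complex.re_le_norm _).trans (norm_inner_le_norm _ _)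
    by_cases h0 : ‖(x : H)‖ = 0
    · rw [h0]; positivity
    · have : 0 < ‖(x : H)‖ := lt_of_le_of_ne (norm_nonneg _) (Ne.symm h0)
      nlinarith
  -- the range is closed
  have hclosed : IsClosed (LinearMap.range S : Set H) := by
    rw [← isSeqClosed_iff_isClosed]
    intro u a hu hua
    choose x hx using hu
    have hc : CauchySeq (fun n => (x n : H)) := by
      rw [Metric.cauchySeq_iff']
      intro ε hε
      obtain ⟨N, hN⟩ := Metric.cauchySeq_iff'.1 hua.cauchySeq ε hε
      refine ⟨N, fun n hn => lt_of_le_of_lt ?_ (hN n hn)⟩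
      rw [dist_eq_norm, dist_eq_norm, ← hx n, ← hx N, ← map_sub]
      exact hlow (x n - x N)
    obtain ⟨b, hb⟩ := cauchySeq_tendsto_of_complete hc
    have hTx : Tendsto (fun n => T (x n)) atTop (𝓝 (a - b)) := by
      have : (fun n => T (x n)) = fun n => u n - (x n : H) := by
        funext n; rw [← hx n, hSapp]; abel
      rw [this]; exact hua.sub hb
    have hg : (b, a - b) ∈ (T.graph : Set (H × H)) := by
      refine hT.isClosed.mem_of_tendsto (hb.prodMk_nhds hTx) (Eventually.of_forall fun n => ?_)
      exact T.mem_graph (x n)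
    obtain ⟨y, hy1, hy2⟩ := (LinearPMap.mem_graph_iff _).1 hg
    refine ⟨y, ?_⟩
    rw [hSapp, hy2, hy1]; simp
  -- the range is everything
  have hsurj : LinearMap.range S = ⊤ := by
    have : CompleteSpace (LinearMap.range S) := hclosed.completeSpace_coe
    rw [← Submodule.orthogonal_eq_bot_iff, Submodule.eq_bot_iff]
    intro y hy
    have hy' : ∀ x : T.domain, inner ℂ (-y) (x : H) = inner ℂ y (T x) := by
      intro x
      have := (Submodule.mem_orthogonal' _ _).1 hy (S x) ⟨x, rfl⟩
      rw [hSapp, inner_add_right] at this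
      rw [inner_neg_left]
      linear_combination -this
    have hyd : y ∈ T.adjoint.domain := LinearPMap.mem_adjoint_domain_of_exists y ⟨-y, hy'⟩
    have hval : T.adjoint ⟨y, hyd⟩ = -y := LinearPMap.adjoint_apply_eq hdense ⟨y, hyd⟩ hy'
    have hyT : ∃ h : y ∈ T.domain, T ⟨y, h⟩ = -y := by
      have : (y, -y) ∈ T.adjoint.graph := by
        rw [← hval]; exact T.adjoint.mem_graph ⟨y, hyd⟩
      rw [hadj] at this
      obtain ⟨w, hw1, hw2⟩ := (LinearPMap.mem_graph_iff _).1 this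
      dsimp only at hw1 hw2
      subst hw1
      exact ⟨w.2, hw2⟩
    obtain ⟨h, hh⟩ := hyT
    have h1 := hlow ⟨y, h⟩
    rw [hSapp, hh] at h1
    simpa using h1
  have hinj : Function.Injective S := by
    rw [injective_iff_map_eq_zero]
    intro x hx
    have h1 := hlow x
    rw [hx, norm_zero] at h1
    exact Subtype.ext (norm_le_zero_iff.1 h1)
  let e : T.domain ≃ₗ[ℂ] H := LinearEquiv.ofBijective S ⟨hinj, LinearMap.range_eq_top.1 hsurj⟩
  have he : ∀ u, S (e.symm u) = u := fun u => e.apply_symm_apply u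
  let R : H →L[ℂ] H := LinearMap.mkContinuous (T.domain.subtype ∘ₗ e.symm.toLinearMap) 1 (by
    intro u
    have := hlow (e.symm u)
    rw [he] at this
    simpa using this)
  have hR : ∀ u, R u = (e.symm u : H) := fun u => rfl
  have hRsym : ∀ u v, inner ℂ (R u) v = inner ℂ u (R v) := by
    intro u v
    have h1 := hsym (e.symm u) (e.symm v)
    conv_lhs => rw [← he v]
    conv_rhs => rw [← he u]
    rw [hR, hR, hSapp, hSapp, inner_add_left, inner_add_right, h1]
  refine ⟨R, ?_, ?_, ?_, ?_⟩
  · intro u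
    exact ⟨(e.symm u).2, he u⟩
  · intro x
    rw [hR]
    exact congrArg Subtype.val (e.symm_apply_apply x)
  · rw [ContinuousLinearMap.nonneg_iff_isPositive]
    refine ⟨fun u v => hRsym u v, fun u => ?_⟩
    have h1 := hre (e.symm u)
    rw [he] at h1
    rw [ContinuousLinearMap.reApplyInnerSelf_apply]
    exact (sq_nonneg _).trans h1
  · rw [ContinuousLinearMap.le_def]
    refine ⟨fun u v => ?_, fun u => ?_⟩
    · have := hRsym u v
      simp only [ContinuousLinearMap.coe_coe, sub_apply,
        one_apply_eq_self, inner_sub_left, inner_sub_right]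
      rw [this]
    · rw [ContinuousLinearMap.reApplyInnerSelf_apply]
      have h2 : RCLike.re (inner ℂ (R u) u) ≤ ‖u‖ * ‖u‖ := by
        refine (RCLike.re_le_norm _).trans ((norm_inner_le_norm _ _).trans ?_)
        have := hlow (e.symm u)
        rw [he] at this
        exact mul_le_mul_of_nonneg_right this (norm_nonneg _)
      simp only [sub_apply, one_apply_eq_self, inner_sub_left,
        map_sub, inner_self_eq_norm_mul_norm]
      linarith

/-- Every nonnegative self-adjoint operator has a nonnegative self-adjoint square root. -/
theorem exists_isPosSqrt [CompleteSpace H] {T : H →ₗ.[ℂ] H} (hT : IsSelfAdjoint T)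
    (hpos : Nonneg T) : ∃ B : H →ₗ.[ℂ] H, IsPosSqrt B T := by
  obtain ⟨Q, hQ1, hQ2, hQ0, hQle⟩ := exists_inverse hT hpos
  have hQ0' : (0 : H →L[ℂ] H) ≤ 1 - Q := sub_nonneg.2 hQle
  let R : H →L[ℂ] H := CFC.sqrt Q
  let S : H →L[ℂ] H := CFC.sqrt (1 - Q)
  have hR0 : 0 ≤ R := CFC.sqrt_nonneg _
  have hS0 : 0 ≤ S := CFC.sqrt_nonneg _
  have hRR : R * R = Q := CFC.sqrt_mul_sqrt_self Q
  have hSS : S * S = 1 - Q := CFC.sqrt_mul_sqrt_self (1 - Q)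
  have hcomm : Commute R S := by
    have h1 : Commute (1 - Q) Q := (Commute.one_left Q).sub_left (Commute.refl Q)
    have h2 : Commute (CFC.sqrt (1 - Q)) Q := h1.cfcₙ_nnreal _
    exact (h2.symm.cfcₙ_nnreal _ : Commute (CFC.sqrt Q) (CFC.sqrt (1 - Q)))
  have hRS0 : 0 ≤ R * S := Commute.mul_nonneg hR0 hS0 hcomm
  have hRR' : ∀ u, R (R u) = Q u := fun u => by rw [← hRR]; rfl
  have hSS' : ∀ u, S (S u) = u - Q u := fun u => by
    have : (S * S) u = (1 - Q) u := by rw [hSS]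
    exact this
  have hRS' : ∀ u, R (S u) = S (R u) := fun u => by
    have : (R * S) u = (S * R) u := by rw [hcomm.eq]
    exact this
  have hRsym : ∀ u v, inner ℂ (R u) v = inner ℂ u (R v) :=
    fun u v => ((ContinuousLinearMap.nonneg_iff_isPositive R).1 hR0).isSymmetric u v
  have hSsym : ∀ u v, inner ℂ (S u) v = inner ℂ u (S v) :=
    fun u v => ((ContinuousLinearMap.nonneg_iff_isPositive S).1 hS0).isSymmetric u v
  have hRinj : ∀ u, R u = 0 → u = 0 := by
    intro u hu
    have h1 : Q u = 0 := by rw [← hRR', hu, map_zero]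
    obtain ⟨h, hh⟩ := hQ1 u
    have h2 : (⟨Q u, h⟩ : T.domain) = 0 := Subtype.ext h1
    rw [h2, LinearPMap.map_zero, h1, add_zero] at hh
    exact hh.symm
  have hRinj' : Function.Injective R := (injective_iff_map_eq_zero R).2 hRinj
  let e : H ≃ₗ[ℂ] LinearMap.range R.toLinearMap := LinearEquiv.ofInjective R.toLinearMap hRinj'
  let B : H →ₗ.[ℂ] H := ⟨LinearMap.range R.toLinearMap, S.toLinearMap ∘ₗ e.symm.toLinearMap⟩
  have hmem : ∀ x, x ∈ B.domain ↔ ∃ u, R u = x := fun x => Iff.rfl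
  have hB : ∀ (u : H) (h : R u ∈ B.domain), B ⟨R u, h⟩ = S u := by
    intro u h
    change S (e.symm ⟨R u, h⟩) = S u
    congr 1
    exact e.symm_apply_apply u
  have hdense : Dense (B.domain : Set H) := by
    rw [Submodule.dense_iff_topologicalClosure_eq_top,
      Submodule.topologicalClosure_eq_top_iff, Submodule.eq_bot_iff]
    intro y hy
    apply hRinj
    have := (Submodule.mem_orthogonal' _ _).1 hy (R (R y)) ⟨R y, rfl⟩
    rw [← hRsym] at this
    exact inner_self_eq_zero.1 this
  have hform : B.IsFormalAdjoint B := by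
    rintro ⟨x, hx⟩ ⟨y, hy⟩
    obtain ⟨u, rfl⟩ := (hmem x).1 hx
    obtain ⟨v, rfl⟩ := (hmem y).1 hy
    rw [hB, hB, hSsym, ← hRS', hRsym]
  have hle : B ≤ B.adjoint := hform.le_adjoint hdense
  have hsa : B.adjoint = B := by
    refine (LinearPMap.eq_of_le_of_domain_eq hle (le_antisymm hle.1 ?_)).symm
    intro y hy
    set w := B.adjoint ⟨y, hy⟩ with hw
    have h1 : ∀ u, inner ℂ w (R u) = inner ℂ y (S u) := by
      intro u
      have hu : R u ∈ B.domain := (hmem _).2 ⟨u, rfl⟩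
      have := LinearPMap.adjoint_isFormalAdjoint hdense ⟨y, hy⟩ ⟨R u, hu⟩
      rw [hB u hu] at this
      exact this
    have h2 : R w = S y := by
      refine ext_inner_right ℂ fun u => ?_
      rw [hRsym, h1, hSsym]
    refine (hmem y).2 ⟨R y + S w, ?_⟩
    rw [map_add, hRR', hRS', h2, hSS']; abel
  refine ⟨B, hsa, ?_, ?_, ?_⟩
  · rintro ⟨x, hx⟩
    obtain ⟨u, rfl⟩ := (hmem x).1 hx
    rw [hB]
    have h1 := ((ContinuousLinearMap.nonneg_iff_isPositive _).1 hRS0).re_inner_nonneg_right u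
    rw [hRsym]
    exact h1
  · intro x
    constructor
    · intro hx
      set z := T ⟨x, hx⟩ + x with hz
      have h1 : Q z = x := hQ2 ⟨x, hx⟩
      have h2 : x = R (R z) := by rw [hRR', h1]
      have hd : R (R z) ∈ B.domain := (hmem _).2 ⟨R z, rfl⟩
      have hd' : B ⟨R (R z), hd⟩ ∈ B.domain := by
        rw [hB, ← hRS']
        exact (hmem _).2 ⟨_, rfl⟩
      rw [h2]
      exact ⟨hd, hd'⟩
    · rintro ⟨h, h'⟩
      obtain ⟨u, rfl⟩ := (hmem x).1 h
      rw [hB] at h'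
      obtain ⟨v, hv⟩ := (hmem _).1 h'
      have h3 : u = R (R u + S v) := by
        rw [map_add, hRR', hRS', hv, hSS']; abel
      rw [h3, hRR']
      exact (hQ1 _).1
  · rintro ⟨x, hx⟩ h h'
    set z := T ⟨x, hx⟩ + x with hz
    have h1 : Q z = x := hQ2 ⟨x, hx⟩
    have h2 : x = R (R z) := by rw [hRR', h1]
    have key : ∀ (y : H) (k : y ∈ B.domain) (k' : B ⟨y, k⟩ ∈ B.domain), y = R (R z) →
        B ⟨B ⟨y, k⟩, k'⟩ = S (S z) := by
      intro y k k' hy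
      subst hy
      have h4 : B ⟨R (R z), k⟩ = R (S z) := by rw [hB, hRS']
      have hd : R (S z) ∈ B.domain := (hmem _).2 ⟨S z, rfl⟩
      have h5 : (⟨B ⟨R (R z), k⟩, k'⟩ : B.domain) = ⟨R (S z), hd⟩ := Subtype.ext h4
      rw [h5, hB]
    rw [key x h h' h2, hSS', h1, hz]; abel

/-- The square root `T^{1/2}` of a nonnegative self-adjoint operator `T`, that is, the (unique)
nonnegative self-adjoint `B` with `B² = T`. -/
def posSqrt [CompleteSpace H] (T : H →ₗ.[ℂ] H) (hT : IsSelfAdjoint T) (hpos : Nonneg T) :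
    H →ₗ.[ℂ] H :=
  (exists_isPosSqrt hT hpos).choose

theorem posSqrt_spec [CompleteSpace H] (T : H →ₗ.[ℂ] H) (hT : IsSelfAdjoint T)
    (hpos : Nonneg T) : IsPosSqrt (posSqrt T hT hpos) T :=
  (exists_isPosSqrt hT hpos).choose_spec

/-! ### The limiting spectra of a regular Galerkin sequence -/

/-- `σ(A, L)` for an `A`-regular Galerkin sequence `L`. -/
def limSpectrum (A : H →ₗ.[ℂ] H) (L : ℕ → Submodule ℂ H) [∀ n, FiniteDimensional ℂ (L n)]
    (hL : IsRegular A L) : Set ℝ :=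
  limitingSpectrum L (fun n => compression A (L n) (hL.1 n))

/-- `σ(A, L)` for `A ≥ 0` and an `A^{1/2}`-regular Galerkin sequence `L`. -/
def formLimSpectrum [CompleteSpace H] (A : H →ₗ.[ℂ] H) (hA : IsSelfAdjoint A) (hpos : Nonneg A)
    (L : ℕ → Submodule ℂ H) [∀ n, FiniteDimensional ℂ (L n)]
    (hL : IsRegular (posSqrt A hA hpos) L) : Set ℝ :=
  limitingSpectrum L (fun n => formCompression (posSqrt A hA hpos) (L n) (hL.1 n))

end Galerkin

end

/-!
Both kinds of compressions `A_n` converge to `A` in the following sense (`IsGraphLimit`): for `x` in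
the domain of `A` there are `g_n ∈ L_n` and `w_n` with `g_n → x`, `w_n → A x` and
`A_n g_n = π_n w_n`. For an `A`-regular sequence this is immediate with `w_n = A g_n`; for form
compressions, `g_n` is the Galerkin solution of `(A + 1) g = (A + 1) x` and the convergence is
Céa's lemma. Only this property enters the rest of the argument.

*Inclusion* (`IsGraphLimit.spectrum_subset`). If a real `t` is not in the limiting spectrum, then
`‖(A_n - t) g‖ ≥ ε ‖g‖` on `L_n` for large `n`. As `‖(A_n - t) g_n‖ ≤ ‖w_n - t g_n‖`, the limit
gives `‖(A - t) x‖ ≥ ε ‖x‖`, so that `t` belongs to the resolvent set.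

*Pollution* (`IsGraphLimit.exists_essSpectrum_lt`). Let `t ∉ σ(A)` be the limit of eigenvalues of
`A_n` with unit eigenvectors `x_n`. Every vector is of the form `(A - t) z`, and testing against it
shows that `x_n` converges weakly to zero (`IsGraphLimit.weakly_null`). If `σ(A)` is bounded from
below, then `A + c` has a bounded inverse `Q ≥ 0` for some `c` (`exists_nonneg_inverse`), and
Jensen's inequality `⟨x_n, Q x_n⟩ ≥ (⟨x_n, A_n x_n⟩ + c)⁻¹` shows that the form of `Q` is
asymptotically at least `(t + c)⁻¹` along a weakly null sequence. The variational characterization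
of the maximum of the essential spectrum (`exists_weyl_ge`) provides a point `M ≥ (t + c)⁻¹` of the
essential spectrum of `Q`, hence the point `M⁻¹ - c ≤ t` of that of `A`. It differs from `t`,
because the essential spectrum is part of the spectrum. The upper end is treated in the same way
with `-A` in place of `A`, by means of a sign `σ = ±1`. For form compressions Jensen's inequality
extends to the form domain at the lower end, and at the upper end `A` is bounded, so that form
compressions are ordinary ones.
-/

noncomputable section

namespace Galerkin

variable {H : Type*} [NormedAddCommGroup H] [InnerProductSpace ℂ H]

/-! ### Resolvents of self-adjoint operators -/

theorem inner_apply_comm [CompleteSpace H] {A : H →ₗ.[ℂ] H} (hA : IsSelfAdjoint A)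
    (x y : A.domain) : inner ℂ (A x) (y : H) = inner ℂ (x : H) (A y) := by
  have h := LinearPMap.adjoint_isFormalAdjoint hA.dense_domain
  rw [show A.adjoint = A from hA] at h
  exact h x y

/-- The basic criterion for a point of the resolvent set of a self-adjoint operator: the lower
bound makes the range of `A - z` closed, and the orthogonal complement of the range is the kernel
of `A - conj z`. -/
theorem mem_resolventSet_of_bound [CompleteSpace H] {A : H →ₗ.[ℂ] H} (hA : IsSelfAdjoint A)
    {z : ℂ} {ε : ℝ} (hε : 0 < ε) (hlow : ∀ x : A.domain, ε * ‖(x : H)‖ ≤ ‖A x - z • (x : H)‖)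
    (hker : ∀ x : A.domain, A x = (starRingEnd ℂ z) • (x : H) → (x : H) = 0) :
    z ∈ resolventSet A := by
  have hadj : A.adjoint = A := hA
  let S : A.domain →ₗ[ℂ] H := A.toFun - z • A.domain.subtype
  have hSapp : ∀ x : A.domain, S x = A x - z • (x : H) := fun x => rfl
  have hlow' : ∀ x : A.domain, ‖(x : H)‖ ≤ ε⁻¹ * ‖S x‖ := by
    intro x
    rw [hSapp, ← div_eq_inv_mul, le_div_iff₀' hε]
    exact hlow x
  have hclosed : IsClosed (LinearMap.range S : Set H) := by
    rw [← isSeqClosed_iff_isClosed]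
    intro u a hu hua
    choose x hx using hu
    have hc : CauchySeq (fun n => (x n : H)) := by
      rw [Metric.cauchySeq_iff']
      intro δ hδ
      obtain ⟨N, hN⟩ := Metric.cauchySeq_iff'.1 hua.cauchySeq (ε * δ) (by positivity)
      refine ⟨N, fun n hn => ?_⟩
      have h1 := hN n hn
      have h2 := hlow (x n - x N)
      rw [← hSapp, map_sub, hx, hx] at h2
      rw [dist_eq_norm] at h1 ⊢
      exact lt_of_mul_lt_mul_left (h2.trans_lt h1) hε.le
    obtain ⟨b, hb⟩ := cauchySeq_tendsto_of_complete hc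
    have hTx : Tendsto (fun n => A (x n)) atTop (𝓝 (a + z • b)) := by
      have : (fun n => A (x n)) = fun n => u n + z • (x n : H) := by
        funext n; rw [← hx n, hSapp]; abel
      rw [this]; exact hua.add (hb.const_smul z)
    have hg : (b, a + z • b) ∈ (A.graph : Set (H × H)) := by
      refine hA.isClosed.mem_of_tendsto (hb.prodMk_nhds hTx) (Eventually.of_forall fun n => ?_)
      exact A.mem_graph (x n)
    obtain ⟨y, hy1, hy2⟩ := (LinearPMap.mem_graph_iff _).1 hg
    refine ⟨y, ?_⟩
    rw [hSapp, hy2, hy1]; simp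
  have hsurj : LinearMap.range S = ⊤ := by
    have : CompleteSpace (LinearMap.range S) := hclosed.completeSpace_coe
    rw [← Submodule.orthogonal_eq_bot_iff, Submodule.eq_bot_iff]
    intro y hy
    have hy' : ∀ x : A.domain, inner ℂ ((starRingEnd ℂ z) • y) (x : H) = inner ℂ y (A x) := by
      intro x
      have := (Submodule.mem_orthogonal' _ _).1 hy (S x) ⟨x, rfl⟩
      rw [hSapp, inner_sub_right, inner_smul_right] at this
      rw [inner_smul_left, Complex.conj_conj]
      linear_combination -this
    have hyd : y ∈ A.adjoint.domain := LinearPMap.mem_adjoint_domain_of_exists y ⟨_, hy'⟩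
    have hval := LinearPMap.adjoint_apply_eq hA.dense_domain ⟨y, hyd⟩ hy'
    have hmem : (y, (starRingEnd ℂ z) • y) ∈ A.adjoint.graph := by
      rw [← hval]; exact A.adjoint.mem_graph ⟨y, hyd⟩
    rw [hadj] at hmem
    obtain ⟨w, hw1, hw2⟩ := (LinearPMap.mem_graph_iff _).1 hmem
    dsimp only at hw1 hw2
    subst hw1
    exact hker w hw2
  have hinj : Function.Injective S := by
    rw [injective_iff_map_eq_zero]
    intro x hx
    have h1 := hlow' x
    rw [hx, norm_zero, mul_zero] at h1
    exact Subtype.ext (norm_le_zero_iff.1 h1)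
  let e : A.domain ≃ₗ[ℂ] H := LinearEquiv.ofBijective S ⟨hinj, LinearMap.range_eq_top.1 hsurj⟩
  have he : ∀ u, S (e.symm u) = u := fun u => e.apply_symm_apply u
  refine ⟨LinearMap.mkContinuous (A.domain.subtype ∘ₗ e.symm.toLinearMap) ε⁻¹ ?_, ?_, ?_⟩
  · intro u
    have := hlow' (e.symm u)
    rwa [he] at this
  · intro u
    exact ⟨(e.symm u).2, he u⟩
  · intro x
    exact congrArg Subtype.val (e.symm_apply_apply x)

theorem im_eq_zero_of_mem_spectrum [CompleteSpace H] {A : H →ₗ.[ℂ] H} (hA : IsSelfAdjoint A)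
    {z : ℂ} (hz : z ∈ spectrum A) : z.im = 0 := by
  by_contra h0
  have hbound : ∀ (w : ℂ) (x : A.domain), |w.im| * ‖(x : H)‖ ≤ ‖A x - w • (x : H)‖ := by
    intro w x
    have hreal : (inner ℂ (x : H) (A x)).im = 0 := by
      rw [← Complex.conj_eq_iff_im, inner_conj_symm, inner_apply_comm hA]
    have h1 : (inner ℂ (x : H) (A x - w • (x : H))).im = -(w.im * ‖(x : H)‖ ^ 2) := by
      rw [inner_sub_right, inner_smul_right, inner_self_eq_norm_sq_to_K, Complex.sub_im, hreal,
        zero_sub]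
      congr 1
      have : ((‖(x : H)‖ : ℂ)) ^ 2 = ((‖(x : H)‖ ^ 2 : ℝ) : ℂ) := by push_cast; rfl
      erw [this, Complex.im_mul_ofReal]
    have h2 : |w.im| * ‖(x : H)‖ ^ 2 ≤ ‖(x : H)‖ * ‖A x - w • (x : H)‖ := by
      refine le_trans (le_of_eq ?_) ((Complex.abs_im_le_norm _).trans (norm_inner_le_norm _ _))
      rw [h1, abs_neg, abs_mul, abs_of_nonneg (sq_nonneg ‖(x : H)‖)]
    by_cases hx : ‖(x : H)‖ = 0
    · rw [hx, mul_zero]; positivity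
    · have : 0 < ‖(x : H)‖ := lt_of_le_of_ne (norm_nonneg _) (Ne.symm hx)
      nlinarith
  refine hz (mem_resolventSet_of_bound hA (abs_pos.2 h0) (hbound z) fun x hx => ?_)
  have h1 := hbound (starRingEnd ℂ z) x
  rw [hx, sub_self, norm_zero, Complex.conj_im, abs_neg] at h1
  have h2 := abs_pos.2 h0
  exact norm_le_zero_iff.1 (by nlinarith [norm_nonneg (x : H)])

theorem essSpectrum_subset_spectrum (A : H →ₗ.[ℂ] H) : essSpectrum A ⊆ spectrum A := by
  rintro z ⟨x, hx, -, hlim⟩ ⟨R, -, hR⟩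
  have h1 : Tendsto (fun k => ‖R (A (x k) - z • (x k : H))‖) atTop (𝓝 ‖R 0‖) :=
    ((R.continuous.tendsto 0).comp hlim).norm
  simp only [hR, hx, map_zero, norm_zero] at h1
  exact one_ne_zero (tendsto_nhds_unique tendsto_const_nhds h1)

/-- The first resolvent identity. -/
theorem resolvent_identity {A : H →ₗ.[ℂ] H} {s t : ℂ} {R R' : H →L[ℂ] H}
    (hR : ∀ x : A.domain, R (A x - s • (x : H)) = x)
    (hR' : ∀ u : H, ∃ h : R' u ∈ A.domain, A ⟨R' u, h⟩ - t • R' u = u) (u : H) :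
    R' u = R u + (t - s) • R (R' u) := by
  obtain ⟨h, hu⟩ := hR' u
  have h1 := hR ⟨R' u, h⟩
  have h2 : A ⟨R' u, h⟩ - s • R' u = u + (t - s) • R' u := by
    nth_rewrite 3 [← hu]
    module
  rw [h2, map_add, map_smul] at h1
  exact h1.symm

/-- `Q` is the inverse of `σ A + c`, defined on all of `H`, bounded and nonnegative. The sign
`σ = ±1` serves to treat both ends of the spectrum of `A` at once. -/
structure IsNonnegInverse (A : H →ₗ.[ℂ] H) (σ c : ℝ) (Q : H →L[ℂ] H) : Prop where
  nonneg : 0 ≤ Q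
  right_inv : ∀ u : H, ∃ h : Q u ∈ A.domain, (σ : ℂ) • A ⟨Q u, h⟩ + (c : ℂ) • Q u = u
  left_inv : ∀ x : A.domain, Q ((σ : ℂ) • A x + (c : ℂ) • (x : H)) = x

/-- If the spectrum of the self-adjoint operator `σ A`, `σ = ±1`, is bounded from below, then
`σ A + c` has a nonnegative bounded inverse for some `c`. The inverse is, up to sign, the resolvent
of `A` at a point outside the convex hull of the spectrum, and its own spectrum is nonnegative. -/
theorem exists_nonneg_inverse [CompleteSpace H] {A : H →ₗ.[ℂ] H} (hA : IsSelfAdjoint A)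
    {σ γ : ℝ} (hσ : σ * σ = 1) (hγ : ∀ t : ℝ, (t : ℂ) ∈ spectrum A → γ ≤ σ * t) :
    ∃ (c : ℝ) (Q : H →L[ℂ] H), IsNonnegInverse A σ c Q := by
  have hσ' : (σ : ℂ) * σ = 1 := by exact_mod_cast hσ
  have hres : ∀ t : ℝ, σ * t < γ → (t : ℂ) ∈ resolventSet A := by
    intro t ht
    by_contra h
    exact absurd (hγ t h) (not_le.2 ht)
  have hs : σ * (σ * (γ - 1)) < γ := by rw [← mul_assoc, hσ]; linarith
  obtain ⟨R, hR1, hR2⟩ := hres _ hs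
  set s : ℝ := σ * (γ - 1) with hsdef
  have hsσ : (s : ℂ) = σ * (γ - 1) := by rw [hsdef]; push_cast; ring
  have hQ1 : ∀ u : H, ∃ h : ((σ : ℂ) • R) u ∈ A.domain,
      (σ : ℂ) • A ⟨((σ : ℂ) • R) u, h⟩ + ((1 - γ : ℝ) : ℂ) • ((σ : ℂ) • R) u = u := by
    intro u
    obtain ⟨h, hu⟩ := hR1 u
    refine ⟨A.domain.smul_mem _ h, ?_⟩
    have h1 : A ⟨((σ : ℂ) • R) u, A.domain.smul_mem _ h⟩ = (σ : ℂ) • A ⟨R u, h⟩ :=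
      A.map_smul (σ : ℂ) ⟨R u, h⟩
    rw [h1, smul_smul, hσ', one_smul, _root_.smul_apply, smul_smul]
    conv_rhs => rw [← hu]
    rw [hsσ]
    push_cast
    module
  have hQ2 : ∀ x : A.domain,
      ((σ : ℂ) • R) ((σ : ℂ) • A x + ((1 - γ : ℝ) : ℂ) • (x : H)) = x := by
    intro x
    rw [_root_.smul_apply, ← map_smul, smul_add, smul_smul, smul_smul, hσ', one_smul]
    refine Eq.trans (congrArg R ?_) (hR2 x)
    rw [hsσ]
    push_cast
    module
  have hsa : IsSelfAdjoint ((σ : ℂ) • R) := by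
    rw [ContinuousLinearMap.isSelfAdjoint_iff_isSymmetric]
    intro u v
    obtain ⟨h, hu⟩ := hQ1 u
    obtain ⟨k, hv⟩ := hQ1 v
    have := inner_apply_comm hA ⟨_, h⟩ ⟨_, k⟩
    conv_lhs => rw [← hv]
    conv_rhs => rw [← hu]
    simp only [ContinuousLinearMap.coe_coe, inner_add_left, inner_add_right, inner_smul_left,
      inner_smul_right, Complex.conj_ofReal] at this ⊢
    rw [this]
  refine ⟨1 - γ, (σ : ℂ) • R, ?_, hQ1, hQ2⟩
  rw [StarOrderedRing.nonneg_iff_spectrum_nonneg (R := ℝ) _ hsa]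
  intro μ hμ
  by_contra! hneg
  refine hμ ?_
  have ht : σ * (s + σ * μ⁻¹) < γ := by
    have : σ * (s + σ * μ⁻¹) = γ - 1 + μ⁻¹ := by
      rw [hsdef]; linear_combination (γ - 1 + μ⁻¹) * hσ
    have := inv_lt_zero.2 hneg
    linarith
  obtain ⟨R', hR'1, hR'2⟩ := hres _ ht
  have hμ0 : (μ : ℂ) ≠ 0 := by exact_mod_cast hneg.ne
  have hone : (σ : ℂ) * (μ : ℂ) * ((σ : ℂ) * (μ : ℂ)⁻¹) = 1 := by
    field_simp
    linear_combination hσ'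
  have e1 : ∀ u, R' u = R u + ((σ : ℂ) * (μ : ℂ)⁻¹) • R (R' u) := fun u => by
    have h := resolvent_identity hR2 hR'1 u
    rw [show (((s + σ * μ⁻¹ : ℝ) : ℂ) - (s : ℂ)) = (σ : ℂ) * (μ : ℂ)⁻¹ by push_cast; ring] at h
    exact h
  have e2 : ∀ u, R u = R' u - ((σ : ℂ) * (μ : ℂ)⁻¹) • R' (R u) := fun u => by
    have h := resolvent_identity hR'2 hR1 u
    rw [show ((s : ℂ) - ((s + σ * μ⁻¹ : ℝ) : ℂ)) = -((σ : ℂ) * (μ : ℂ)⁻¹) by push_cast; ring] at h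
    rw [sub_eq_add_neg, ← neg_smul]
    exact h
  -- the inverse of `μ - Q` is `μ⁻¹ (1 + σ μ⁻¹ R')`
  let K : H →L[ℂ] H := (μ : ℂ)⁻¹ • (1 + ((σ : ℂ) * (μ : ℂ)⁻¹) • R')
  have hK : ∀ u, K u = (μ : ℂ)⁻¹ • (u + ((σ : ℂ) * (μ : ℂ)⁻¹) • R' u) := fun u => rfl
  have hD : ∀ u, (algebraMap ℝ (H →L[ℂ] H) μ - (σ : ℂ) • R) u = (μ : ℂ) • u - (σ : ℂ) • R u :=
    fun u => by
      rw [sub_apply, Algebra.algebraMap_eq_smul_one]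
      rfl
  change IsUnit (algebraMap ℝ (H →L[ℂ] H) μ - (σ : ℂ) • R)
  rw [ContinuousLinearMap.isUnit_iff_bijective]
  refine ⟨Function.LeftInverse.injective (g := K) fun u => ?_,
    Function.RightInverse.surjective (g := K) fun u => ?_⟩
  · rw [hD, hK, map_sub, map_smul, map_smul]
    have h := e2 u
    have h' : R' (R u) = ((σ : ℂ) * (μ : ℂ)) • (R' u - R u) := by
      have h'' : R' u - R u = ((σ : ℂ) * (μ : ℂ)⁻¹) • R' (R u) :=
        sub_eq_of_eq_add' (sub_eq_iff_eq_add.1 h.symm)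
      rw [h'', smul_smul, hone, one_smul]
    rw [h']
    match_scalars <;> field_simp <;>
      first | linear_combination (σ : ℂ) * hσ' | linear_combination -(σ : ℂ) * hσ'
  · rw [hD, hK, map_smul, map_add, map_smul]
    have h' : R (R' u) = ((σ : ℂ) * (μ : ℂ)) • (R' u - R u) := by
      nth_rewrite 2 [e1 u]
      rw [add_sub_cancel_left, smul_smul, hone, one_smul]
    rw [h']
    match_scalars <;> field_simp <;>
      first | linear_combination (σ : ℂ) * hσ' | linear_combination -(σ : ℂ) * hσ'

/-! ### The maximum of the essential spectrum of a bounded operator -/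

/-- The Cauchy–Schwarz inequality for a quadratic form that is nonnegative on a subspace. -/
theorem sq_re_inner_le {T : H →ₗ[ℂ] H} (hT : T.IsSymmetric) (V : Submodule ℂ H)
    (hpos : ∀ x ∈ V, 0 ≤ (inner ℂ (T x) x).re) {x y : H} (hx : x ∈ V) (hy : y ∈ V) :
    (inner ℂ (T x) y).re ^ 2 ≤ (inner ℂ (T x) x).re * (inner ℂ (T y) y).re := by
  have h : ∀ s : ℝ, 0 ≤ (inner ℂ (T y) y).re * (s * s) + 2 * (inner ℂ (T x) y).re * s +
      (inner ℂ (T x) x).re := by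
    intro s
    have h1 := hpos (x + (s : ℂ) • y) (V.add_mem hx (V.smul_mem _ hy))
    have h2 : (inner ℂ (T y) x).re = (inner ℂ (T x) y).re := by
      rw [hT, ← inner_conj_symm, Complex.conj_re]
    simp only [map_add, map_smul, inner_add_left, inner_add_right, inner_smul_left,
      inner_smul_right, Complex.conj_ofReal, Complex.add_re, Complex.re_ofReal_mul, h2] at h1
    linarith
  have := discrim_le_zero h
  rw [discrim] at this
  nlinarith

theorem tendsto_inner_of_orthonormal {v : ℕ → H} (hv : Orthonormal ℂ v) (y : H) :
    Tendsto (fun k => inner ℂ y (v k)) atTop (𝓝 0) := by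
  rw [tendsto_zero_iff_norm_tendsto_zero]
  have h1 := (hv.inner_products_summable y).tendsto_atTop_zero.sqrt
  simpa [norm_inner_symm] using h1

/-- The projections of a weakly null sequence to a finite-dimensional subspace tend to zero in
norm. -/
theorem tendsto_starProjection_of_weakly_null {x : ℕ → H}
    (hw : ∀ y : H, Tendsto (fun k => inner ℂ y (x k)) atTop (𝓝 0))
    (V : Submodule ℂ H) [FiniteDimensional ℂ V] :
    Tendsto (fun k => V.starProjection (x k)) atTop (𝓝 0) := by
  have h1 : ∀ k, V.starProjection (x k) =
      ∑ i, inner ℂ ((stdOrthonormalBasis ℂ V i : V) : H) (x k) •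
        ((stdOrthonormalBasis ℂ V i : V) : H) := fun k => by
    rw [(stdOrthonormalBasis ℂ V).starProjection_eq_sum_rankOne]
    simp
  simp only [h1]
  have h2 : (0 : H) = ∑ i, (0 : ℂ) • ((stdOrthonormalBasis ℂ V i : V) : H) := by simp
  rw [h2]
  exact tendsto_finsetSum _ fun i _ => (hw _).smul_const _

/-- If on every subspace of finite codimension there are unit vectors on which `T - M` is
arbitrarily small, then `T` has an orthonormal, hence singular, Weyl sequence at `M`. -/
theorem exists_weyl_of_finite_codim (T : H →L[ℂ] H) (M : ℂ)
    (h : ∀ (V : Submodule ℂ H) [FiniteDimensional ℂ V], ∀ ε : ℝ, 0 < ε →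
      ∃ y ∈ Vᗮ, ‖y‖ = 1 ∧ ‖T y - M • y‖ < ε) :
    ∃ y : ℕ → H, (∀ k, ‖y k‖ = 1) ∧ (∀ v : H, Tendsto (fun k => inner ℂ v (y k)) atTop (𝓝 0)) ∧
      Tendsto (fun k => T (y k) - M • y k) atTop (𝓝 0) := by
  classical
  -- each vector carries an index, which prescribes the accuracy and increases along the sequence
  obtain ⟨f, hP, hr⟩ := exists_seq_of_forall_finset_exists
    (fun p : ℕ × H => ‖p.2‖ = 1 ∧ ‖T p.2 - M • p.2‖ < 1 / ((p.1 : ℝ) + 1))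
    (fun p q => p.1 < q.1 ∧ inner ℂ p.2 q.2 = 0) (by
      intro s _
      obtain ⟨y, hyV, hy1, hy2⟩ := h (Submodule.span ℂ (s.image Prod.snd : Set H))
        (1 / (((s.sup Prod.fst + 1 : ℕ) : ℝ) + 1)) (by positivity)
      refine ⟨(s.sup Prod.fst + 1, y), ⟨hy1, hy2⟩, fun p hp => ⟨?_, ?_⟩⟩
      · exact Nat.lt_succ_of_le (Finset.le_sup (f := Prod.fst) hp)
      · exact (Submodule.mem_orthogonal _ _).1 hyV _
          (Submodule.subset_span (Finset.mem_coe.2 (Finset.mem_image_of_mem _ hp))))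
  have hon : Orthonormal ℂ fun k => (f k).2 := by
    refine ⟨fun k => (hP k).1, fun i j hij => ?_⟩
    rcases lt_or_gt_of_ne hij with hlt | hlt
    · exact (hr i j hlt).2
    · exact inner_eq_zero_symm.1 (hr j i hlt).2
  have hmono : StrictMono fun k => (f k).1 := fun i j hij => (hr i j hij).1
  refine ⟨fun k => (f k).2, fun k => (hP k).1, tendsto_inner_of_orthonormal hon, ?_⟩
  rw [tendsto_zero_iff_norm_tendsto_zero]
  refine squeeze_zero (fun _ => norm_nonneg _) (fun k => (hP k).2.le) ?_
  exact (tendsto_one_div_add_atTop_nhds_zero_nat (𝕜 := ℝ)).comp hmono.tendsto_atTop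

/-- If the quadratic form of a bounded self-adjoint operator is asymptotically at least `a` along
a weakly null sequence of unit vectors, then the operator has a singular Weyl sequence at some
`M ≥ a`. Here `M` is the infimum of the suprema of the numerical range over the subspaces of finite
codimension, that is, the maximum of the essential spectrum. -/
theorem exists_weyl_ge (T : H →L[ℂ] H) (hT : T.toLinearMap.IsSymmetric)
    {x : ℕ → H} (hx : ∀ k, ‖x k‖ = 1)
    (hw : ∀ y : H, Tendsto (fun k => inner ℂ y (x k)) atTop (𝓝 0)) {b : ℕ → ℝ} {a : ℝ}
    (hb : Tendsto b atTop (𝓝 a)) (hbT : ∀ᶠ k in atTop, b k ≤ (inner ℂ (T (x k)) (x k)).re) :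
    ∃ M : ℝ, a ≤ M ∧ ∃ y : ℕ → H, (∀ k, ‖y k‖ = 1) ∧
      (∀ v : H, Tendsto (fun k => inner ℂ v (y k)) atTop (𝓝 0)) ∧
      Tendsto (fun k => T (y k) - (M : ℂ) • y k) atTop (𝓝 0) := by
  let S : Set ℝ := {m | ∃ V : Submodule ℂ H, FiniteDimensional ℂ V ∧
    ∀ y ∈ Vᗮ, (inner ℂ (T y) y).re ≤ m * ‖y‖ ^ 2}
  have hbound : ∀ y, |(inner ℂ (T y) y).re| ≤ ‖T‖ * ‖y‖ ^ 2 := by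
    intro y
    refine (Complex.abs_re_le_norm _).trans ((norm_inner_le_norm _ _).trans ?_)
    rw [sq, ← mul_assoc]
    exact mul_le_mul_of_nonneg_right (T.le_opNorm y) (norm_nonneg _)
  have hSne : S.Nonempty := ⟨‖T‖, ⊥, inferInstance, fun y _ => (le_abs_self _).trans (hbound y)⟩
  have hSa : ∀ m ∈ S, a ≤ m := by
    rintro m ⟨V, hV, hm⟩
    have hP := tendsto_starProjection_of_weakly_null hw V
    -- compare `x k` with its component orthogonal to `V`
    have hform : ∀ k, (inner ℂ (T (x k)) (x k)).re ≤
        m * ‖x k - V.starProjection (x k)‖ ^ 2 +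
          3 * ‖T‖ * ‖V.starProjection (x k)‖ := by
      intro k
      set p := V.starProjection (x k) with hp
      have hmem : x k - p ∈ Vᗮ := V.sub_starProjection_mem_orthogonal (x k)
      have h1 := hm _ hmem
      have hple : ‖p‖ ≤ 1 := (V.norm_starProjection_apply_le (x k)).trans (hx k).le
      have h2 : (inner ℂ (T (x k)) (x k)).re = (inner ℂ (T (x k - p)) (x k - p)).re +
          (inner ℂ (T p) (x k)).re + (inner ℂ (T (x k)) p).re - (inner ℂ (T p) p).re := by
        rw [map_sub]
        simp only [inner_sub_left, inner_sub_right, Complex.sub_re]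
        ring
      have hn : ∀ u v : H, |(inner ℂ (T u) v).re| ≤ ‖T‖ * ‖u‖ * ‖v‖ := fun u v =>
        (Complex.abs_re_le_norm _).trans ((norm_inner_le_norm _ _).trans
          (mul_le_mul_of_nonneg_right (T.le_opNorm u) (norm_nonneg _)))
      have h3 := (abs_le.1 (hn p (x k))).2
      have h4 := (abs_le.1 (hn (x k) p)).2
      have h5 := (abs_le.1 (hn p p)).1
      rw [hx k, mul_one] at h3 h4
      have h6 : ‖T‖ * ‖p‖ * ‖p‖ ≤ ‖T‖ * ‖p‖ := mul_le_of_le_one_right (by positivity) hple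
      linarith
    have hlim : Tendsto (fun k => m * ‖x k - V.starProjection (x k)‖ ^ 2 +
          3 * ‖T‖ * ‖V.starProjection (x k)‖) atTop (𝓝 (m * 1 ^ 2 + 3 * ‖T‖ * ‖(0 : H)‖)) := by
      refine ((Tendsto.pow ?_ 2).const_mul m).add (hP.norm.const_mul _)
      have h0 : Tendsto (fun k => ‖V.starProjection (x k)‖) atTop (𝓝 0) := by
        simpa using hP.norm
      have h1 : Tendsto (fun k => 1 - ‖V.starProjection (x k)‖) atTop (𝓝 1) := by
        simpa using h0.const_sub 1
      have h2 : Tendsto (fun k => 1 + ‖V.starProjection (x k)‖) atTop (𝓝 1) := by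
        simpa using h0.const_add 1
      refine tendsto_of_tendsto_of_tendsto_of_le_of_le h1 h2 (fun k => ?_) (fun k => ?_)
      · have := norm_sub_norm_le (x k) (V.starProjection (x k))
        rwa [hx k] at this
      · have := norm_sub_le (x k) (V.starProjection (x k))
        rwa [hx k] at this
    have h := le_of_tendsto_of_tendsto hb hlim (hbT.mono fun k hk => hk.trans (hform k))
    simpa using h
  have hbdd : BddBelow S := ⟨a, fun m hm => hSa m hm⟩
  set M := sInf S with hM
  refine ⟨M, le_csInf hSne hSa, exists_weyl_of_finite_codim T M fun V hV ε hε => ?_⟩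
  -- on `Wᗮ` the form of `M + δ - T` is nonnegative
  set C : ℝ := |M| + 1 + ‖T‖ with hC
  have hCpos : 0 < C := by positivity
  obtain ⟨δ, hδ0, hδ1, hδε⟩ : ∃ δ : ℝ, 0 < δ ∧ δ ≤ 1 ∧ 2 * δ * C + 2 * δ < (ε / 2) ^ 2 ∧
      δ ≤ ε / 2 := by
    refine ⟨min (min 1 (ε / 2)) ((ε / 2) ^ 2 / (4 * (C + 1))),
      lt_min (lt_min one_pos (half_pos hε)) (by positivity),
      (min_le_left _ _).trans (min_le_left _ _), ?_, (min_le_left _ _).trans (min_le_right _ _)⟩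
    have h1 := min_le_right (min 1 (ε / 2)) ((ε / 2) ^ 2 / (4 * (C + 1)))
    rw [le_div_iff₀ (by positivity)] at h1
    have : 0 < (ε / 2) ^ 2 := by positivity
    nlinarith
  obtain ⟨m, ⟨W₀, hW₀, hm⟩, hmlt⟩ := exists_lt_of_csInf_lt hSne (show sInf S < M + δ by linarith)
  let W : Submodule ℂ H := V ⊔ W₀
  -- a nearly maximizing vector, chosen orthogonal to `T W` as well, so that `T y` stays in `Wᗮ`
  let U : Submodule ℂ H := W ⊔ W.map T.toLinearMap
  have hUS : M - δ ∉ S := fun h => by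
    have := csInf_le hbdd h
    linarith
  obtain ⟨y, hyU, hy⟩ : ∃ y ∈ Uᗮ, (M - δ) * ‖y‖ ^ 2 < (inner ℂ (T y) y).re := by
    by_contra! hcon
    exact hUS ⟨U, inferInstance, hcon⟩
  have hy0 : y ≠ 0 := by
    rintro rfl
    simp at hy
  have hny : 0 < ‖y‖ := norm_pos_iff.2 hy0
  have hyW : y ∈ Wᗮ := Submodule.orthogonal_le le_sup_left hyU
  have hTyW : T y ∈ Wᗮ := by
    rw [Submodule.mem_orthogonal]
    intro w hw
    have h1 := (Submodule.mem_orthogonal _ _).1 hyU (T w)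
      (Submodule.mem_sup_right (Submodule.mem_map_of_mem hw))
    have h2 := hT w y
    simp only [ContinuousLinearMap.coe_coe] at h2
    rw [← h2, h1]
  let D : H →ₗ[ℂ] H := ((M + δ : ℝ) : ℂ) • LinearMap.id - T.toLinearMap
  have hD : ∀ u, D u = ((M + δ : ℝ) : ℂ) • u - T u := fun u => rfl
  have hDsym : D.IsSymmetric := by
    intro u v
    have := hT u v
    simp only [ContinuousLinearMap.coe_coe] at this
    rw [hD, hD, inner_sub_left, inner_sub_right, inner_smul_left, inner_smul_right,
      Complex.conj_ofReal, this]
  have hDform : ∀ u, (inner ℂ (D u) u).re = (M + δ) * ‖u‖ ^ 2 - (inner ℂ (T u) u).re := by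
    intro u
    rw [hD, inner_sub_left, inner_smul_left, Complex.conj_ofReal, Complex.sub_re,
      Complex.re_ofReal_mul]
    congr 2
    exact inner_self_eq_norm_sq (𝕜 := ℂ) u
  have hDpos : ∀ u ∈ Wᗮ, 0 ≤ (inner ℂ (D u) u).re := by
    intro u hu
    have h1 := hm u (Submodule.orthogonal_le le_sup_right hu)
    rw [hDform]
    nlinarith [sq_nonneg ‖u‖]
  have hDy : D y ∈ Wᗮ := Submodule.sub_mem _ (Submodule.smul_mem _ _ hyW) hTyW
  have hCS := sq_re_inner_le hDsym Wᗮ hDpos hyW hDy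
  have hself : (inner ℂ (D y) (D y)).re = ‖D y‖ ^ 2 := inner_self_eq_norm_sq (𝕜 := ℂ) (D y)
  have hq1 : (inner ℂ (D y) y).re ≤ 2 * δ * ‖y‖ ^ 2 := by
    rw [hDform]; linarith
  have hq2 : (inner ℂ (D (D y)) (D y)).re ≤ C * ‖D y‖ ^ 2 := by
    rw [hDform]
    have h1 := (abs_le.1 (hbound (D y))).1
    have h2 : M + δ ≤ |M| + 1 := add_le_add (le_abs_self M) hδ1
    have h3 := mul_le_mul_of_nonneg_right h2 (sq_nonneg ‖D y‖)
    rw [hC]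
    linarith
  have hfin : ‖D y‖ ^ 2 ≤ 2 * δ * C * ‖y‖ ^ 2 := by
    by_cases h0 : ‖D y‖ = 0
    · rw [h0, zero_pow two_ne_zero]; positivity
    · have hpos : 0 < ‖D y‖ ^ 2 := by positivity
      rw [hself] at hCS
      have h1 : (‖D y‖ ^ 2) ^ 2 ≤ (2 * δ * ‖y‖ ^ 2) * (C * ‖D y‖ ^ 2) :=
        hCS.trans (mul_le_mul hq1 hq2 (hDpos _ hDy) (by positivity))
      refine le_of_mul_le_mul_right ?_ hpos
      nlinarith
  have hDlt : ‖D y‖ < ε / 2 * ‖y‖ := by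
    refine lt_of_pow_lt_pow_left₀ 2 (by positivity) ?_
    rw [mul_pow]
    have h1 : 2 * δ * C < (ε / 2) ^ 2 := by linarith [hδε.1]
    exact hfin.trans_lt (mul_lt_mul_of_pos_right h1 (by positivity))
  have hTM : ‖T y - (M : ℂ) • y‖ < ε * ‖y‖ := by
    have h1 : T y - (M : ℂ) • y = (δ : ℂ) • y - D y := by
      rw [hD]; push_cast; module
    have h2 : ‖(δ : ℂ) • y‖ = δ * ‖y‖ := by
      rw [norm_smul, Complex.norm_real, Real.norm_of_nonneg hδ0.le]
    rw [h1]
    have h3 := norm_sub_le ((δ : ℂ) • y) (D y)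
    have h4 := mul_le_mul_of_nonneg_right hδε.2 hny.le
    linarith
  refine ⟨((‖y‖⁻¹ : ℝ) : ℂ) • y, ?_, ?_, ?_⟩
  · exact Submodule.smul_mem _ _ (Submodule.orthogonal_le le_sup_left hyW)
  · rw [norm_smul, Complex.norm_real, norm_inv, norm_norm, inv_mul_cancel₀ hny.ne']
  · rw [map_smul, smul_comm, ← smul_sub, norm_smul, Complex.norm_real, norm_inv, norm_norm,
      inv_mul_lt_iff₀ hny, mul_comm]
    exact hTM

/-! ### Strong graph limits -/

/-- The symmetric operators `An n` on `L n` converge to `A` in the sense of strong graph limits: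
every pair `(x, A x)` is the limit of pairs `(g n, w n)` with `g n ∈ L n` and
`An n (g n) = π_n (w n)`, where `π_n` is the orthogonal projection onto `L n`. The last equation is
expressed by testing against the vectors of `L n`. -/
structure IsGraphLimit (A : H →ₗ.[ℂ] H) (L : ℕ → Submodule ℂ H)
    (An : ∀ n, Module.End ℂ (L n)) : Prop where
  symmetric : ∀ n, (An n).IsSymmetric
  approx : ∀ x : A.domain, ∃ (g : ∀ n, L n) (w : ℕ → H),
    Tendsto (fun n => (g n : H)) atTop (𝓝 x) ∧ Tendsto w atTop (𝓝 (A x)) ∧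
    ∀ n (z : L n), inner ℂ (z : H) (An n (g n) : H) = inner ℂ (z : H) (w n)

theorem mul_norm_le_norm_sub_smul {V : Type*} [NormedAddCommGroup V] [InnerProductSpace ℂ V]
    [FiniteDimensional ℂ V] {T : Module.End ℂ V} (hT : T.IsSymmetric) {z : ℂ} {ε : ℝ}
    (hε : 0 ≤ ε) (hgap : ∀ μ ∈ _root_.spectrum ℂ T, ε ≤ ‖μ - z‖) (x : V) :
    ε * ‖x‖ ≤ ‖T x - z • x‖ := by
  let b := hT.eigenvectorBasis rfl
  refine le_of_sq_le_sq ?_ (norm_nonneg _)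
  rw [mul_pow, ← b.repr.norm_map x, ← b.repr.norm_map (T x - z • x), EuclideanSpace.norm_sq_eq,
    EuclideanSpace.norm_sq_eq, Finset.mul_sum]
  refine Finset.sum_le_sum fun i _ => ?_
  have h1 : (b.repr (T x - z • x)).ofLp i =
      ((hT.eigenvalues rfl i : ℂ) - z) * (b.repr x).ofLp i := by
    rw [map_sub, map_smul, sub_mul]
    change (b.repr (T x)).ofLp i - z * (b.repr x).ofLp i = _
    rw [hT.eigenvectorBasis_apply_self_apply rfl x i]
    rfl
  rw [h1, norm_mul, mul_pow]
  have h2 := hgap _ (hT.hasEigenvalue_eigenvalues rfl i).mem_spectrum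
  gcongr
  exact h2

/-- Away from the limiting spectrum the operators `An n - t` have a uniform spectral gap. -/
theorem exists_gap_of_notMem_limitingSpectrum {L : ℕ → Submodule ℂ H}
    {An : ∀ n, Module.End ℂ (L n)} {t : ℝ} (ht : t ∉ limitingSpectrum L An) :
    ∃ ε : ℝ, 0 < ε ∧ ∀ᶠ n in atTop, ∀ μ ∈ _root_.spectrum ℂ (An n), ε ≤ ‖μ - t‖ := by
  by_contra! hcon
  have h : ∀ k : ℕ, ∃ n, k ≤ n ∧ ∃ μ ∈ _root_.spectrum ℂ (An n), ‖μ - t‖ < 1 / ((k : ℝ) + 1) := by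
    intro k
    have h1 := hcon (1 / ((k : ℝ) + 1)) (by positivity)
    obtain ⟨n, hn, h2⟩ := (frequently_atTop.1 h1) k
    exact ⟨n, hn, h2⟩
  choose φ hφ μ hμ hlt using h
  refine ht ⟨φ, μ, tendsto_atTop_mono hφ tendsto_id, hμ, ?_⟩
  rw [tendsto_iff_norm_sub_tendsto_zero]
  exact squeeze_zero (fun _ => norm_nonneg _) (fun k => (hlt k).le)
    tendsto_one_div_add_atTop_nhds_zero_nat

/-- Every point of `σ(A)` is a limit of eigenvalues of the `An n`: a uniform spectral gap of the
`An n` around `t` would pass to the limit as a lower bound of `A - t`. -/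
theorem IsGraphLimit.spectrum_subset [CompleteSpace H] {A : H →ₗ.[ℂ] H} (hA : IsSelfAdjoint A)
    {L : ℕ → Submodule ℂ H} [∀ n, FiniteDimensional ℂ (L n)] {An : ∀ n, Module.End ℂ (L n)}
    (hG : IsGraphLimit A L An) :
    spectrum A ⊆ (fun t : ℝ => (t : ℂ)) '' limitingSpectrum L An := by
  intro z hz
  have hzre : ((z.re : ℝ) : ℂ) = z :=
    Complex.ext rfl (by simpa using (im_eq_zero_of_mem_spectrum hA hz).symm)
  refine ⟨z.re, ?_, hzre⟩
  by_contra ht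
  obtain ⟨ε, hε, hgap⟩ := exists_gap_of_notMem_limitingSpectrum ht
  rw [hzre] at hgap
  have hlow : ∀ x : A.domain, ε * ‖(x : H)‖ ≤ ‖A x - z • (x : H)‖ := by
    intro x
    obtain ⟨g, w, hg, hw, hgw⟩ := hG.approx x
    refine le_of_tendsto_of_tendsto (hg.norm.const_mul ε) (hw.sub (hg.const_smul z)).norm ?_
    filter_upwards [hgap] with n hn
    have h1 := mul_norm_le_norm_sub_smul (hG.symmetric n) hε.le hn (g n)
    set v : L n := An n (g n) - z • g n with hv
    have h2 : ‖v‖ ^ 2 ≤ ‖v‖ * ‖w n - z • (g n : H)‖ := by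
      have h3 : inner ℂ (v : H) (v : H) = inner ℂ (v : H) (w n - z • (g n : H)) := by
        have hvc : (v : H) = (An n (g n) : H) - z • (g n : H) := rfl
        refine (congrArg (inner ℂ (v : H)) hvc).trans ?_
        rw [inner_sub_right, inner_sub_right, hgw n v]
      have h4 : ‖inner ℂ (v : H) (v : H)‖ = ‖v‖ ^ 2 := by
        rw [inner_self_eq_norm_sq_to_K]; simp
      rw [← h4, h3]
      exact norm_inner_le_norm _ _
    have h5 : ‖v‖ ≤ ‖w n - z • (g n : H)‖ := by
      by_cases h0 : ‖v‖ = 0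
      · rw [h0]; positivity
      · have : 0 < ‖v‖ := lt_of_le_of_ne (norm_nonneg _) (Ne.symm h0)
        nlinarith
    exact h1.trans h5
  refine hz (mem_resolventSet_of_bound hA hε hlow fun x hx => ?_)
  have h1 := hlow x
  rw [← hzre, Complex.conj_ofReal] at hx
  rw [← hzre, hx, sub_self, norm_zero] at h1
  exact norm_le_zero_iff.1 (by nlinarith [norm_nonneg (x : H)])

/-- Unit eigenvectors of the `An n` belonging to eigenvalues that tend to a point outside the
spectrum of `A` converge weakly to zero. Indeed every vector has the form `(A - t) z`, and on
`(A - t) z` such eigenvectors are asymptotically annihilated. -/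
theorem IsGraphLimit.weakly_null {A : H →ₗ.[ℂ] H}
    {L : ℕ → Submodule ℂ H} {An : ∀ n, Module.End ℂ (L n)}
    (hG : IsGraphLimit A L An) {t : ℝ} (ht : (t : ℂ) ∉ spectrum A)
    {φ : ℕ → ℕ} (hφ : Tendsto φ atTop atTop) {μ : ℕ → ℂ} (hμ : Tendsto μ atTop (𝓝 (t : ℂ)))
    {x : ∀ k, L (φ k)} (hx : ∀ k, ‖(x k : H)‖ = 1) (hev : ∀ k, An (φ k) (x k) = μ k • x k)
    (y : H) : Tendsto (fun k => inner ℂ y (x k : H)) atTop (𝓝 0) := by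
  obtain ⟨R, hR, -⟩ := not_not.1 ht
  obtain ⟨h, hy⟩ := hR y
  obtain ⟨g, w, hg, hw, hgw⟩ := hG.approx ⟨R y, h⟩
  have h1 : Tendsto (fun k => y - (w (φ k) - (t : ℂ) • (g (φ k) : H))) atTop (𝓝 0) := by
    have h2 := (((hw.comp hφ).sub ((hg.comp hφ).const_smul (t : ℂ)))).const_sub y
    rw [hy, sub_self] at h2
    exact h2
  have h3 : ∀ k, inner ℂ y (x k : H) = inner ℂ (y - (w (φ k) - (t : ℂ) • (g (φ k) : H))) (x k : H) +
      (μ k - t) * inner ℂ (g (φ k) : H) (x k : H) := by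
    intro k
    have h4 : inner ℂ (w (φ k)) (x k : H) = μ k * inner ℂ (g (φ k) : H) (x k : H) := by
      have h5 := hG.symmetric (φ k) (g (φ k)) (x k)
      rw [Submodule.coe_inner, Submodule.coe_inner, hev, Submodule.coe_smul,
        inner_smul_right] at h5
      rw [← h5, ← inner_conj_symm, ← hgw, inner_conj_symm]
    rw [inner_sub_left, inner_sub_left, inner_smul_left, Complex.conj_ofReal, h4]
    ring
  have hgx : ∀ k, ‖(μ k - t) * inner ℂ (g (φ k) : H) (x k : H)‖ ≤ ‖μ k - t‖ * ‖(g (φ k) : H)‖ := by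
    intro k
    rw [norm_mul]
    have := norm_inner_le_norm (𝕜 := ℂ) (g (φ k) : H) (x k : H)
    rw [hx, mul_one] at this
    gcongr
  have hμ' : Tendsto (fun k => ‖μ k - t‖) atTop (𝓝 0) := tendsto_iff_norm_sub_tendsto_zero.1 hμ
  have hlim2 : Tendsto (fun k => (μ k - t) * inner ℂ (g (φ k) : H) (x k : H)) atTop (𝓝 0) :=
    squeeze_zero_norm hgx (by simpa using hμ'.mul (hg.comp hφ).norm)
  have hlim1 : Tendsto (fun k => inner ℂ (y - (w (φ k) - (t : ℂ) • (g (φ k) : H))) (x k : H))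
      atTop (𝓝 0) := by
    refine squeeze_zero_norm (fun k => ?_) (by simpa using h1.norm)
    have := norm_inner_le_norm (𝕜 := ℂ) (y - (w (φ k) - (t : ℂ) • (g (φ k) : H))) (x k : H)
    rwa [hx, mul_one] at this
  simp only [h3]
  simpa using hlim1.add hlim2

/-! ### Spectral pollution -/

/-- A singular Weyl sequence of `Q = (σ A + c)⁻¹` at `M ≠ 0` is mapped by `Q` to one of `A` at
`σ (M⁻¹ - c)`. -/
theorem mem_essSpectrum_of_weyl_inverse {A : H →ₗ.[ℂ] H} {σ c M : ℝ} (hσ : σ * σ = 1)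
    {Q : H →L[ℂ] H} (hsym : Q.toLinearMap.IsSymmetric)
    (hQ : ∀ u : H, ∃ h : Q u ∈ A.domain, (σ : ℂ) • A ⟨Q u, h⟩ + (c : ℂ) • Q u = u) (hM : 0 < M)
    {y : ℕ → H} (hy : ∀ k, ‖y k‖ = 1)
    (hw : ∀ v : H, Tendsto (fun k => inner ℂ v (y k)) atTop (𝓝 0))
    (hlim : Tendsto (fun k => Q (y k) - (M : ℂ) • y k) atTop (𝓝 0)) :
    ((σ * (M⁻¹ - c) : ℝ) : ℂ) ∈ essSpectrum A := by
  have hnorm : Tendsto (fun k => ‖Q (y k)‖) atTop (𝓝 M) := by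
    have h0 : Tendsto (fun k => ‖Q (y k) - (M : ℂ) • y k‖) atTop (𝓝 0) := by simpa using hlim.norm
    rw [tendsto_iff_norm_sub_tendsto_zero]
    refine squeeze_zero (fun _ => norm_nonneg _) (fun k => ?_) h0
    have h1 : ‖(M : ℂ) • y k‖ = M := by
      rw [norm_smul, hy, mul_one, Complex.norm_real, Real.norm_of_nonneg hM.le]
    have h2 := abs_norm_sub_norm_le (Q (y k)) ((M : ℂ) • y k)
    rwa [h1] at h2
  obtain ⟨N, hN⟩ := eventually_atTop.1 (hnorm.eventually (lt_mem_nhds (half_lt_self hM)))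
  have hpos : ∀ k, 0 < ‖Q (y (k + N))‖ := fun k =>
    (half_pos hM).trans (hN (k + N) (Nat.le_add_left _ _))
  have hshift : Tendsto (fun k : ℕ => k + N) atTop atTop := tendsto_add_atTop_nat N
  have hinv : Tendsto (fun k => (((‖Q (y (k + N))‖⁻¹ : ℝ)) : ℂ)) atTop (𝓝 ((M⁻¹ : ℝ) : ℂ)) :=
    (Complex.continuous_ofReal.tendsto _).comp ((hnorm.comp hshift).inv₀ hM.ne')
  choose hmem hQ' using hQ
  have hσ' : (σ : ℂ) * σ = 1 := by exact_mod_cast hσ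
  refine ⟨fun k => (((‖Q (y (k + N))‖⁻¹ : ℝ)) : ℂ) • ⟨Q (y (k + N)), hmem _⟩, fun k => ?_,
    fun v => ?_, ?_⟩
  · rw [Submodule.coe_smul, norm_smul, Complex.norm_real, norm_inv, norm_norm,
      inv_mul_cancel₀ (hpos k).ne']
  · have h1 := hinv.mul ((hw (Q v)).comp hshift)
    rw [mul_zero] at h1
    refine h1.congr fun k => ?_
    have h2 := hsym v (y (k + N))
    simp only [ContinuousLinearMap.coe_coe] at h2
    rw [Submodule.coe_smul, inner_smul_right, Function.comp_apply, h2]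
  · have h1 := hinv.smul (((hlim.comp hshift).const_smul (-((σ : ℂ) * ((M⁻¹ : ℝ) : ℂ)))))
    rw [smul_zero, smul_zero] at h1
    refine h1.congr fun k => ?_
    have h2 : A ⟨Q (y (k + N)), hmem _⟩ =
        (σ : ℂ) • (y (k + N) - (c : ℂ) • Q (y (k + N))) := by
      have h3 := eq_sub_of_add_eq (hQ' (y (k + N)))
      rw [← h3, smul_smul, hσ', one_smul]
    have hM' : (M : ℂ) ≠ 0 := by exact_mod_cast hM.ne'
    rw [LinearPMap.map_smul, Submodule.coe_smul, h2, smul_comm ((σ * (M⁻¹ - c) : ℝ) : ℂ),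
      ← smul_sub]
    congr 1
    simp only [Function.comp_apply]
    push_cast
    match_scalars <;> field_simp
    ring

/-- Pollution lies strictly inside the convex hull of the essential spectrum, on the side where
`σ A`, `σ = ±1`, is semibounded: a polluting point `t` forces a point `μ` of the essential
spectrum with `σ μ < σ t`. For unit vectors `x` the hypothesis `hform` is Jensen's inequality
`⟨x, Q x⟩⁻¹ ≤ ⟨x, Q⁻¹ x⟩`, with the form of `σ An n + c` in place of that of `Q⁻¹`. -/
theorem IsGraphLimit.exists_essSpectrum_lt [CompleteSpace H] {A : H →ₗ.[ℂ] H}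
    {L : ℕ → Submodule ℂ H} [∀ n, FiniteDimensional ℂ (L n)] {An : ∀ n, Module.End ℂ (L n)}
    (hG : IsGraphLimit A L An) {σ c : ℝ} (hσ : σ * σ = 1) {Q : H →L[ℂ] H}
    (hQ : IsNonnegInverse A σ c Q)
    (hform : ∀ n (x : L n), ‖(x : H)‖ ^ 4 ≤ (inner ℂ (Q x) (x : H)).re *
      (σ * (inner ℂ (x : H) (An n x : H)).re + c * ‖(x : H)‖ ^ 2))
    {t : ℝ} (ht : t ∈ limitingSpectrum L An) (htA : (t : ℂ) ∉ spectrum A) :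
    ∃ μ : ℝ, (μ : ℂ) ∈ essSpectrum A ∧ σ * μ < σ * t := by
  obtain ⟨φ, ν, hφ, hν, hlim⟩ := ht
  have hQpos := (ContinuousLinearMap.nonneg_iff_isPositive Q).1 hQ.nonneg
  have hev : ∀ k, ∃ x : L (φ k), ‖(x : H)‖ = 1 ∧ An (φ k) x = ν k • x := by
    intro k
    obtain ⟨v, hv⟩ := (Module.End.hasEigenvalue_iff_mem_spectrum.2 (hν k)).exists_hasEigenvector
    have hv0 : (v : H) ≠ 0 := fun h => hv.2 (Subtype.ext h)
    refine ⟨((‖(v : H)‖⁻¹ : ℝ) : ℂ) • v, ?_, ?_⟩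
    · rw [Submodule.coe_smul, norm_smul, Complex.norm_real, norm_inv, norm_norm,
        inv_mul_cancel₀ (norm_ne_zero_iff.2 hv0)]
    · rw [map_smul, hv.apply_eq_smul, smul_comm]
  choose x hx hxev using hev
  have hw := hG.weakly_null htA hφ hlim hx hxev
  have hre : Tendsto (fun k => σ * (ν k).re + c) atTop (𝓝 (σ * t + c)) :=
    (((Complex.continuous_re.tendsto _).comp hlim).const_mul σ).add_const c
  have hQx : ∀ k, 1 ≤ (inner ℂ (Q (x k)) (x k : H)).re * (σ * (ν k).re + c) := by
    intro k
    have h1 := hform (φ k) (x k)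
    have h2 : inner ℂ (x k : H) ((ν k • x k : L (φ k)) : H) = ν k := by
      rw [Submodule.coe_smul, inner_smul_right, inner_self_eq_norm_sq_to_K, hx]; simp
    rw [hxev, h2, hx] at h1
    simpa using h1
  have hp0 : ∀ k, 0 ≤ (inner ℂ (Q (x k)) (x k : H)).re := fun k =>
    hQpos.re_inner_nonneg_left (x k : H)
  have hpQ : ∀ k, (inner ℂ (Q (x k)) (x k : H)).re ≤ ‖Q‖ := by
    intro k
    refine (Complex.re_le_norm _).trans ((norm_inner_le_norm _ _).trans ?_)
    have := Q.le_opNorm (x k)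
    rwa [hx, mul_one] at this ⊢
  have hfac : ∀ k, 0 < σ * (ν k).re + c := fun k => by
    by_contra! h
    nlinarith [hQx k, hp0 k]
  have hd : 0 < σ * t + c := by
    have h1 : 1 ≤ ‖Q‖ * (σ * t + c) :=
      ge_of_tendsto' (hre.const_mul ‖Q‖) fun k =>
        (hQx k).trans (mul_le_mul_of_nonneg_right (hpQ k) (hfac k).le)
    by_contra! h
    nlinarith [norm_nonneg Q]
  obtain ⟨M, hM, y, hy, hyw, hylim⟩ := exists_weyl_ge Q hQpos.isSymmetric hx hw
    (hre.inv₀ hd.ne') (Eventually.of_forall fun k => by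
      rw [inv_le_iff_one_le_mul₀ (hfac k)]
      exact hQx k)
  have hMpos : 0 < M := (inv_pos.2 hd).trans_le hM
  have hess := mem_essSpectrum_of_weyl_inverse hσ hQpos.isSymmetric hQ.right_inv hMpos hy hyw hylim
  refine ⟨_, hess, lt_of_le_of_ne ?_ fun heq => ?_⟩
  · rw [← mul_assoc, hσ, one_mul]
    have := (inv_le_comm₀ hMpos hd).2 hM
    linarith
  · have h1 : σ * (M⁻¹ - c) = t := by
      have := congrArg (σ * ·) heq
      simp only [← mul_assoc, hσ, one_mul] at this
      exact this
    rw [h1] at hess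
    exact htA (essSpectrum_subset_spectrum A hess)

/-! ### Compressions and form compressions -/

theorem inner_compression (A : H →ₗ.[ℂ] H) (V : Submodule ℂ H) [FiniteDimensional ℂ V]
    (hV : V ≤ A.domain) (z x : V) :
    inner ℂ (z : H) (compression A V hV x : H) = inner ℂ (z : H) (A ⟨x, hV x.2⟩) := by
  rw [← Submodule.coe_inner]
  exact Submodule.inner_orthogonalProjectionOnto_eq_of_mem_left z (A ⟨x, hV x.2⟩)

theorem IsRegular.exists_tendsto {T : H →ₗ.[ℂ] H} {L : ℕ → Submodule ℂ H} (hL : IsRegular T L)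
    (f : T.domain) : ∃ g : ∀ n, L n, Tendsto (fun n => (g n : H)) atTop (𝓝 f) ∧
      Tendsto (fun n => T ⟨g n, hL.1 n (g n).2⟩) atTop (𝓝 (T f)) := by
  obtain ⟨g, hg, hlim⟩ := hL.2 f
  refine ⟨fun n => ⟨g n, hg n⟩, ?_, ?_⟩
  · rw [tendsto_iff_norm_sub_tendsto_zero]
    exact squeeze_zero (fun _ => norm_nonneg _)
      (fun n => le_add_of_nonneg_right (norm_nonneg _)) hlim
  · rw [tendsto_iff_norm_sub_tendsto_zero]
    exact squeeze_zero (fun _ => norm_nonneg _)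
      (fun n => le_add_of_nonneg_left (norm_nonneg _)) hlim

theorem IsRegular.isGraphLimit [CompleteSpace H] {A : H →ₗ.[ℂ] H} (hA : IsSelfAdjoint A)
    {L : ℕ → Submodule ℂ H} [∀ n, FiniteDimensional ℂ (L n)] (hL : IsRegular A L) :
    IsGraphLimit A L fun n => compression A (L n) (hL.1 n) where
  symmetric n x y := by
    rw [Submodule.coe_inner, Submodule.coe_inner, inner_compression, ← inner_conj_symm,
      inner_compression, inner_conj_symm]
    exact inner_apply_comm hA ⟨x, hL.1 n x.2⟩ ⟨y, hL.1 n y.2⟩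
  approx x := by
    obtain ⟨g, hg, hTg⟩ := hL.exists_tendsto x
    exact ⟨g, _, hg, hTg, fun n z => inner_compression _ _ _ _ _⟩

theorem IsPosSqrt.inner_apply [CompleteSpace H] {A B : H →ₗ.[ℂ] H} (hB : IsPosSqrt B A)
    (z : B.domain) (x : A.domain) (hx : (x : H) ∈ B.domain) :
    inner ℂ (z : H) (A x) = inner ℂ (B z) (B ⟨x, hx⟩) := by
  obtain ⟨h, h'⟩ := (hB.mem_iff x).1 x.2
  rw [← hB.apply_eq x h h', ← inner_apply_comm hB.selfAdjoint z ⟨_, h'⟩]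

/-- For the form compressions the approximating vectors `g n` are the Galerkin solutions of
`(A + 1) g = f`. By Galerkin orthogonality, `g n` is the best approximation from `L n` of the exact
solution `x` with respect to the form norm `‖x‖² + ‖B x‖²` (Céa's lemma). -/
theorem IsPosSqrt.isGraphLimit [CompleteSpace H] {A B : H →ₗ.[ℂ] H} (hB : IsPosSqrt B A)
    {L : ℕ → Submodule ℂ H} [∀ n, FiniteDimensional ℂ (L n)] (hL : IsRegular B L) :
    IsGraphLimit A L fun n => formCompression B (L n) (hL.1 n) where
  symmetric n x y := by
    rw [Submodule.coe_inner, Submodule.coe_inner, inner_formCompression, ← inner_conj_symm,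
      inner_formCompression, inner_conj_symm]
  approx x := by
    obtain ⟨hxB, -⟩ := (hB.mem_iff x).1 x.2
    have hsol : ∀ n, ∃ g : L n, ∀ z : L n,
        inner ℂ (z : H) (formCompression B (L n) (hL.1 n) g : H) + inner ℂ (z : H) (g : H) =
          inner ℂ (z : H) (A x + (x : H)) := by
      intro n
      let S : Module.End ℂ (L n) := formCompression B (L n) (hL.1 n) + 1
      have hS : ∀ g : L n, (S g : H) = formCompression B (L n) (hL.1 n) g + (g : H) := fun _ => rfl
      have hinj : Function.Injective S := by
        rw [injective_iff_map_eq_zero]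
        intro g hg
        have h1 : inner ℂ (g : H) (S g : H) = 0 := by rw [hg]; simp
        have h2 := congrArg Complex.re h1
        have h4 : (inner ℂ (g : H) (g : H)).re = ‖(g : H)‖ ^ 2 := inner_self_eq_norm_sq (𝕜 := ℂ) _
        have h5 : (inner ℂ (B ⟨g, hL.1 n g.2⟩) (B ⟨g, hL.1 n g.2⟩)).re =
            ‖B ⟨g, hL.1 n g.2⟩‖ ^ 2 := inner_self_eq_norm_sq (𝕜 := ℂ) _
        rw [hS, inner_add_right, inner_formCompression, Complex.add_re, h4, h5,
          Complex.zero_re] at h2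
        have h3 : ‖(g : H)‖ = 0 := by nlinarith [sq_nonneg ‖B ⟨g, hL.1 n g.2⟩‖, norm_nonneg (g : H)]
        exact Subtype.ext (norm_eq_zero.1 h3)
      obtain ⟨g, hg⟩ := LinearMap.injective_iff_surjective.1 hinj
        ((L n).orthogonalProjectionOnto (A x + (x : H)))
      refine ⟨g, fun z => ?_⟩
      rw [← inner_add_right, ← hS, hg, ← Submodule.coe_inner]
      exact Submodule.inner_orthogonalProjectionOnto_eq_of_mem_left z _
    choose g hg using hsol
    have hgx : Tendsto (fun n => (g n : H)) atTop (𝓝 x) := by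
      obtain ⟨u, hu, hBu⟩ := hL.exists_tendsto ⟨x, hxB⟩
      rw [tendsto_iff_norm_sub_tendsto_zero]
      have hlim : Tendsto (fun n => Real.sqrt (‖(u n : H) - x‖ ^ 2 +
          ‖B ⟨u n, hL.1 n (u n).2⟩ - B ⟨x, hxB⟩‖ ^ 2)) atTop (𝓝 0) := by
        have h1 := (((tendsto_iff_norm_sub_tendsto_zero.1 hu).pow 2).add
          ((tendsto_iff_norm_sub_tendsto_zero.1 hBu).pow 2)).sqrt
        simpa using h1
      refine squeeze_zero (fun _ => norm_nonneg _) (fun n => Real.le_sqrt_of_sq_le ?_) hlim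
      -- the error `e` is orthogonal to `v = u n - g n` in the form inner product
      let v : L n := u n - g n
      set e : B.domain := ⟨g n, hL.1 n (g n).2⟩ - ⟨x, hxB⟩ with he
      set v' : B.domain := ⟨v, hL.1 n v.2⟩ with hv'
      have horth : inner ℂ (v : H) (e : H) + inner ℂ (B v') (B e) = 0 := by
        have h1 := hg n v
        rw [inner_formCompression, inner_add_right,
          hB.inner_apply ⟨v, hL.1 n v.2⟩ x hxB] at h1
        have h2 : (e : H) = (g n : H) - x := rfl
        rw [h2, he, LinearPMap.map_sub, inner_sub_right, inner_sub_right]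
        linear_combination h1
      have hsum1 : (u n : H) - x = v + e := by
        simp only [v, he, Submodule.coe_sub]; abel
      have hsum2 : B ⟨u n, hL.1 n (u n).2⟩ - B ⟨x, hxB⟩ = B v' + B e := by
        rw [← LinearPMap.map_add, ← LinearPMap.map_sub]
        congr 1
        exact Subtype.ext hsum1
      have hre : (inner ℂ (v : H) (e : H)).re + (inner ℂ (B v') (B e)).re = 0 := by
        rw [← Complex.add_re, horth, Complex.zero_re]
      have hn1 := norm_add_sq (𝕜 := ℂ) (v : H) (e : H)
      have hn2 := norm_add_sq (𝕜 := ℂ) (B v') (B e)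
      simp only [RCLike.re_eq_complex_re] at hn1 hn2
      rw [hsum1, hsum2, hn1, hn2]
      change ‖(e : H)‖ ^ 2 ≤ _
      nlinarith [sq_nonneg ‖(v : H)‖, sq_nonneg ‖B v'‖, sq_nonneg ‖B e‖]
    refine ⟨g, fun n => A x + (x : H) - g n, hgx, ?_, fun n z => ?_⟩
    · simpa using hgx.const_sub (A x + (x : H))
    · rw [inner_sub_right, ← hg n z, add_sub_cancel_right]

/-- For a unit vector `x` this is Jensen's inequality `⟨x, Q x⟩⁻¹ ≤ ⟨x, Q⁻¹ x⟩`; it follows from the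
Cauchy–Schwarz inequality for the form of `Q`, applied to `Q⁻¹ x` and `x`. -/
theorem IsNonnegInverse.norm_pow_four_le [CompleteSpace H] {A : H →ₗ.[ℂ] H} {σ c : ℝ}
    {Q : H →L[ℂ] H} (hQ : IsNonnegInverse A σ c Q) (x : A.domain) :
    ‖(x : H)‖ ^ 4 ≤ (inner ℂ (Q x) (x : H)).re *
      (σ * (inner ℂ (x : H) (A x)).re + c * ‖(x : H)‖ ^ 2) := by
  have hpos := (ContinuousLinearMap.nonneg_iff_isPositive Q).1 hQ.nonneg
  have h := sq_re_inner_le hpos.isSymmetric ⊤ (fun y _ => hpos.re_inner_nonneg_left y)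
    (Submodule.mem_top (x := (σ : ℂ) • A x + (c : ℂ) • (x : H)))
    (Submodule.mem_top (x := (x : H)))
  have h1 : (inner ℂ (x : H) (x : H)).re = ‖(x : H)‖ ^ 2 := inner_self_eq_norm_sq (𝕜 := ℂ) _
  simp only [ContinuousLinearMap.coe_coe] at h
  rw [hQ.left_inv, h1, inner_add_right, inner_smul_right, inner_smul_right, Complex.add_re,
    Complex.re_ofReal_mul, Complex.re_ofReal_mul, h1] at h
  nlinarith

/-- For `A ≥ 0` the Jensen-type inequality extends from the domain of `A` to the form domain. -/
theorem IsPosSqrt.norm_pow_four_le [CompleteSpace H] {A B : H →ₗ.[ℂ] H} (hB : IsPosSqrt B A)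
    {Q : H →L[ℂ] H} (hQ : IsNonnegInverse A 1 1 Q) (x : B.domain) :
    ‖(x : H)‖ ^ 4 ≤ (inner ℂ (Q x) (x : H)).re * (‖B x‖ ^ 2 + ‖(x : H)‖ ^ 2) := by
  obtain ⟨h, hx⟩ := hQ.right_inv x
  simp only [Complex.ofReal_one, one_smul] at hx
  obtain ⟨hy, -⟩ := (hB.mem_iff _).1 h
  have h1 : ∀ z : B.domain, (inner ℂ (z : H) (x : H)).re =
      (inner ℂ (B z) (B ⟨Q x, hy⟩)).re + (inner ℂ (z : H) (Q x)).re := by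
    intro z
    conv_lhs => rw [← hx]
    rw [inner_add_right, hB.inner_apply z ⟨Q x, h⟩ hy, Complex.add_re]
  have h2 : (inner ℂ (Q x) (x : H)).re = ‖B ⟨Q x, hy⟩‖ ^ 2 + ‖Q x‖ ^ 2 := by
    have h3 := h1 ⟨Q x, hy⟩
    have h4 : (inner ℂ (Q x) (Q x)).re = ‖Q x‖ ^ 2 := inner_self_eq_norm_sq (𝕜 := ℂ) _
    have h5 : (inner ℂ (B ⟨Q x, hy⟩) (B ⟨Q x, hy⟩)).re = ‖B ⟨Q x, hy⟩‖ ^ 2 :=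
      inner_self_eq_norm_sq (𝕜 := ℂ) _
    rwa [h4, h5] at h3
  have h6 : ‖(x : H)‖ ^ 2 ≤ ‖B x‖ * ‖B ⟨Q x, hy⟩‖ + ‖(x : H)‖ * ‖Q x‖ := by
    have h4 : (inner ℂ (x : H) (x : H)).re = ‖(x : H)‖ ^ 2 := inner_self_eq_norm_sq (𝕜 := ℂ) _
    rw [← h4, h1 x]
    exact add_le_add ((Complex.re_le_norm _).trans (norm_inner_le_norm _ _))
      ((Complex.re_le_norm _).trans (norm_inner_le_norm _ _))
  rw [h2]
  calc ‖(x : H)‖ ^ 4 = (‖(x : H)‖ ^ 2) ^ 2 := by ring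
    _ ≤ (‖B x‖ * ‖B ⟨Q x, hy⟩‖ + ‖(x : H)‖ * ‖Q x‖) ^ 2 := by gcongr
    _ ≤ _ := by nlinarith [sq_nonneg (‖B x‖ * ‖Q x‖ - ‖(x : H)‖ * ‖B ⟨Q x, hy⟩‖)]

theorem exists_isNonnegInverse_one [CompleteSpace H] {A : H →ₗ.[ℂ] H} (hA : IsSelfAdjoint A)
    (hpos : Nonneg A) : ∃ Q : H →L[ℂ] H, IsNonnegInverse A 1 1 Q := by
  obtain ⟨Q, h1, h2, h3, -⟩ := exists_inverse hA hpos
  exact ⟨Q, h3, by simpa using h1, by simpa using h2⟩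

/-- A nonnegative self-adjoint operator that is also bounded from above is everywhere defined:
`(1 + A)⁻¹` is bounded from below on the dense domain of `A`, so its range, which is the domain of
`A`, is closed. -/
theorem domain_eq_top_of_bounded [CompleteSpace H] {A : H →ₗ.[ℂ] H} (hA : IsSelfAdjoint A)
    (hpos : Nonneg A) {c : ℝ} {Q : H →L[ℂ] H} (hQ : IsNonnegInverse A (-1) c Q) :
    A.domain = ⊤ := by
  obtain ⟨P, hP⟩ := exists_isNonnegInverse_one hA hpos
  have hupper : ∀ x : A.domain, (inner ℂ (x : H) (A x)).re ≤ |c| * ‖(x : H)‖ ^ 2 := by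
    intro x
    have h1 := hQ.norm_pow_four_le x
    have h0 : 0 ≤ (inner ℂ (Q x) (x : H)).re :=
      ((ContinuousLinearMap.nonneg_iff_isPositive Q).1 hQ.nonneg).re_inner_nonneg_left (x : H)
    have h2 : c * ‖(x : H)‖ ^ 2 ≤ |c| * ‖(x : H)‖ ^ 2 :=
      mul_le_mul_of_nonneg_right (le_abs_self c) (sq_nonneg _)
    by_cases hx : ‖(x : H)‖ = 0
    · rw [norm_eq_zero.1 hx]; simp
    · have h3 : 0 < ‖(x : H)‖ ^ 4 := by positivity
      by_contra! hlt
      nlinarith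
  have hlowD : ∀ x : A.domain, ‖(x : H)‖ ≤ (|c| + 1) * ‖P x‖ := by
    intro x
    by_cases hx : ‖(x : H)‖ = 0
    · rw [hx]; positivity
    · have hx' : 0 < ‖(x : H)‖ := lt_of_le_of_ne (norm_nonneg _) (Ne.symm hx)
      have h1 := hP.norm_pow_four_le x
      rw [one_mul, one_mul] at h1
      have h2 : (inner ℂ (P x) (x : H)).re ≤ ‖P x‖ * ‖(x : H)‖ :=
        (Complex.re_le_norm _).trans (norm_inner_le_norm _ _)
      have h3 : (inner ℂ (x : H) (A x)).re + ‖(x : H)‖ ^ 2 ≤ (|c| + 1) * ‖(x : H)‖ ^ 2 := by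
        linarith [hupper x]
      have h4 : 0 ≤ (inner ℂ (x : H) (A x)).re + ‖(x : H)‖ ^ 2 := add_nonneg (hpos x) (sq_nonneg _)
      have h5 := h1.trans (mul_le_mul h2 h3 h4 (by positivity))
      refine le_of_mul_le_mul_right ?_ (pow_pos hx' 3)
      linarith
  have hlow : ∀ x : H, ‖x‖ ≤ (|c| + 1) * ‖P x‖ := by
    have hcl : IsClosed {x : H | ‖x‖ ≤ (|c| + 1) * ‖P x‖} :=
      isClosed_le continuous_norm (by fun_prop)
    intro x
    exact closure_minimal (fun y hy => hlowD ⟨y, hy⟩) hcl (hA.dense_domain x)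
  have hrange : Set.range P = A.domain := by
    refine Set.Subset.antisymm ?_ fun x hx => ⟨_, hP.left_inv ⟨x, hx⟩⟩
    rintro _ ⟨u, rfl⟩
    exact (hP.right_inv u).1
  have hclosed : IsClosed (A.domain : Set H) := by
    rw [← hrange]
    have hanti : AntilipschitzWith (Real.toNNReal (|c| + 1)) P :=
      AddMonoidHomClass.antilipschitz_of_bound P fun x => by
        rw [Real.coe_toNNReal _ (by positivity)]
        exact hlow x
    exact hanti.isClosed_range P.uniformContinuous
  refine SetLike.coe_injective ?_
  rw [← hclosed.closure_eq, hA.dense_domain.closure_eq]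
  rfl

/-! ### The limiting spectrum -/

/-- Both assertions for the limiting spectrum of a graph limit, provided that every semibound of
`A` is inherited by the `An` in the form of the Jensen-type inequality. -/
theorem IsGraphLimit.spectrum_subset_and_pollution [CompleteSpace H] {A : H →ₗ.[ℂ] H}
    (hA : IsSelfAdjoint A) {L : ℕ → Submodule ℂ H} [∀ n, FiniteDimensional ℂ (L n)]
    {An : ∀ n, Module.End ℂ (L n)} (hG : IsGraphLimit A L An)
    (hform : ∀ (σ c : ℝ) (Q : H →L[ℂ] H), (σ = 1 ∨ σ = -1) → IsNonnegInverse A σ c Q →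
      ∃ (c' : ℝ) (Q' : H →L[ℂ] H), IsNonnegInverse A σ c' Q' ∧
        ∀ n (x : L n), ‖(x : H)‖ ^ 4 ≤ (inner ℂ (Q' x) (x : H)).re *
          (σ * (inner ℂ (x : H) (An n x : H)).re + c' * ‖(x : H)‖ ^ 2)) :
    spectrum A ⊆ (fun t : ℝ => (t : ℂ)) '' limitingSpectrum L An ∧
      ∀ t ∈ pollution A (limitingSpectrum L An),
        ellMinus A < (t : EReal) ∧ (t : EReal) < ellPlus A := by
  have key : ∀ (σ γ : ℝ), (σ = 1 ∨ σ = -1) → (∀ s : ℝ, (s : ℂ) ∈ spectrum A → γ ≤ σ * s) →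
      ∀ t ∈ pollution A (limitingSpectrum L An),
        ∃ μ : ℝ, (μ : ℂ) ∈ essSpectrum A ∧ σ * μ < σ * t := by
    intro σ γ hσ hγ t ht
    have hσ' : σ * σ = 1 := mul_self_eq_one_iff.2 hσ
    obtain ⟨c, Q, hQ⟩ := exists_nonneg_inverse hA hσ' hγ
    obtain ⟨c', Q', hQ', hf⟩ := hform σ c Q hσ hQ
    exact hG.exists_essSpectrum_lt hσ' hQ' hf ht.1 ht.2
  refine ⟨hG.spectrum_subset hA, fun t ht => ⟨?_, ?_⟩⟩
  · unfold ellMinus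
    split_ifs with h
    · exact EReal.bot_lt_coe t
    · obtain ⟨γ, -, hγ⟩ := EReal.lt_iff_exists_real_btwn.1 (bot_lt_iff_ne_bot.2 h)
      obtain ⟨μ, hμ, hlt⟩ := key 1 γ (Or.inl rfl) (fun s hs => by
        have hmem : (s : EReal) ∈ realPoints (spectrum A) := ⟨s, hs, rfl⟩
        rw [one_mul]
        exact EReal.coe_le_coe_iff.1 (hγ.le.trans (sInf_le hmem))) t ht
      rw [one_mul, one_mul] at hlt
      have hmem : (μ : EReal) ∈ realPoints (essSpectrum A) := ⟨μ, hμ, rfl⟩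
      exact (sInf_le hmem).trans_lt (EReal.coe_lt_coe_iff.2 hlt)
  · unfold ellPlus
    split_ifs with h
    · exact EReal.coe_lt_top t
    · obtain ⟨γ, hγ, -⟩ := EReal.lt_iff_exists_real_btwn.1 (lt_top_iff_ne_top.2 h)
      obtain ⟨μ, hμ, hlt⟩ := key (-1) (-γ) (Or.inr rfl) (fun s hs => by
        have hmem : (s : EReal) ∈ realPoints (spectrum A) := ⟨s, hs, rfl⟩
        have h1 := EReal.coe_le_coe_iff.1 ((le_sSup hmem).trans hγ.le)
        linarith) t ht
      have hlt' : t < μ := by linarith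
      have hmem : (μ : EReal) ∈ realPoints (essSpectrum A) := ⟨μ, hμ, rfl⟩
      exact (EReal.coe_lt_coe_iff.2 hlt').trans_le (le_sSup hmem)

end Galerkin

end

theorem proposition2p2 {H : Type*} [NormedAddCommGroup H] [InnerProductSpace ℂ H]
    [CompleteSpace H] (A : H →ₗ.[ℂ] H) (hA : IsSelfAdjoint A)
    (L : ℕ → Submodule ℂ H) [∀ n, FiniteDimensional ℂ (L n)] :
    (∀ hL : Galerkin.IsRegular A L,
      Galerkin.spectrum A ⊆ (fun t : ℝ => (t : ℂ)) '' Galerkin.limSpectrum A L hL ∧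
      ∀ t ∈ Galerkin.pollution A (Galerkin.limSpectrum A L hL),
        Galerkin.ellMinus A < (t : EReal) ∧ (t : EReal) < Galerkin.ellPlus A) ∧
    (∀ (hpos : Galerkin.Nonneg A) (hL : Galerkin.IsRegular (Galerkin.posSqrt A hA hpos) L),
      Galerkin.spectrum A ⊆
        (fun t : ℝ => (t : ℂ)) '' Galerkin.formLimSpectrum A hA hpos L hL ∧
      ∀ t ∈ Galerkin.pollution A (Galerkin.formLimSpectrum A hA hpos L hL),
        Galerkin.ellMinus A < (t : EReal) ∧ (t : EReal) < Galerkin.ellPlus A) := by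
  refine ⟨fun hL => ?_, fun hpos hL => ?_⟩
  · refine (hL.isGraphLimit hA).spectrum_subset_and_pollution hA fun σ c Q _ hQ =>
      ⟨c, Q, hQ, fun n x => ?_⟩
    rw [Galerkin.inner_compression]
    exact hQ.norm_pow_four_le ⟨x, hL.1 n x.2⟩
  · have hB := Galerkin.posSqrt_spec A hA hpos
    refine (hB.isGraphLimit hL).spectrum_subset_and_pollution hA fun σ c Q hσ hQ => ?_
    rcases hσ with rfl | rfl
    · obtain ⟨P, hP⟩ := Galerkin.exists_isNonnegInverse_one hA hpos
      refine ⟨1, P, hP, fun n x => ?_⟩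
      have h1 : (inner ℂ (Galerkin.posSqrt A hA hpos ⟨x, hL.1 n x.2⟩)
          (Galerkin.posSqrt A hA hpos ⟨x, hL.1 n x.2⟩)).re =
          ‖Galerkin.posSqrt A hA hpos ⟨x, hL.1 n x.2⟩‖ ^ 2 := inner_self_eq_norm_sq (𝕜 := ℂ) _
      rw [Galerkin.inner_formCompression, h1, one_mul, one_mul]
      exact hB.norm_pow_four_le hP ⟨x, hL.1 n x.2⟩
    · -- here `A` is bounded, so the form compression is the ordinary one
      have htop := Galerkin.domain_eq_top_of_bounded hA hpos hQ
      refine ⟨c, Q, hQ, fun n x => ?_⟩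
      have hx : (x : H) ∈ A.domain := htop ▸ Submodule.mem_top
      rw [Galerkin.inner_formCompression,
        ← hB.inner_apply ⟨x, hL.1 n x.2⟩ ⟨x, hx⟩ (hL.1 n x.2)]
      exact hQ.norm_pow_four_le ⟨x, hx⟩
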